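/- All graphs are finite and simple. Let $L$ be a graph and $S'\subseteq V(L)$. The pair $(L,S')$ is *knitted* if for every partition of $S'$ into parts $S_1,\dots,S_t$ with $|S_i|\in\{1,2\}$ there are pairwise vertex-disjoint connected subgraphs $C_1,\dots,C_t$ of $L$ with $S_i\subseteq V(C_i)$ for all $i$. A *separation* of $(L,S')$ is a pair $(A,B)$ with $V(L)=A\cup B$, $S'\subseteq A$, and no edge of $L$ between $A\setminus B$ and $B\setminus A$; its *order* is $|A\cap B|$. It is *rigid* if $B\setminus A\neq\emptyset$ and $(L[B],A\cap B)$ is knitted. For $T\subseteq V(L)$ let $\rho(T)$ be the number of edges of $L$ with at least one endpoint in $T$. For an integer $p\ge 0$, $(L,S')$ is *$p$-massed* if $\rho(V(L)\setminus S')>\frac p2|V(L)\setminus S'|$ and every separation $(A,B)$ of $(L,S')$ of order at most $|S'|-1$ satisfies $\rho(B\setminus A)\le\frac p2|B\setminus A|$. Let $l,p\ge 0$ be integers with $l\le\lfloor p/2\rfloor-1$. The pair $(L,S')$ is *$p$-minimal* (with respect to $l$) if (1) $(L,S')$ is $p$-massed; (2) $|S'|\le l$ and $(L,S')$ is not knitted;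 (3) among all pairs satisfying (1)–(2), $|V(L)|$ is minimum; (4) among all pairs satisfying (1)–(3), $\rho(V(L)\setminus S')$ is minimum; (5) among all pairs satisfying (1)–(4), the number of edges of $L[S']$ is maximum. **Theorem.** Let $(L,S')$ be $p$-minimal with respect to some integer $0\le l\le\lfloor p/2\rfloor-1$. Then $(L,S')$ has no rigid separation of order at most $|S'|$. Moreover, there is a vertex $v\in V(L)\setminus S'$ such that the subgraph $H$ of $L$ induced by the closed neighbourhood $N[v]$, with $n(H)$ vertices and minimum degree $\delta(H)$, satisfies at least one of the following: (i) $n(H)\le p$ and $\delta(H)\ge\lfloor p/2\rfloor+1$; (ii) $n(H)\le p-2$, $\delta(H)\ge\lfloor p/2\rfloor$, and $H$ has at most two vertices of degree exactly $\lfloor p/2\rfloor$, which are non-adjacent if there are two of them; (iii) $n(H)\le p-4$ and $\delta(H)\ge\lfloor p/2\rfloor$. -/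

import Mathlib

universe u

namespace KnittedPairs

/-- `(L, S)` is knitted: for every partition `P` of `S` into parts with one or two elements there
are pairwise vertex-disjoint connected subgraphs of `L`, one for each part and containing it. -/
def Knitted {V : Type u} (L : SimpleGraph V) (S : Set V) : Prop :=
  ∀ P : Set (Set V), P.PairwiseDisjoint id → ⋃₀ P = S →
    (∀ X ∈ P, X.ncard = 1 ∨ X.ncard = 2) →
    ∃ C : Set V → L.Subgraph,
      (∀ X ∈ P, X ⊆ (C X).verts ∧ (C X).Connected) ∧
      ∀ X ∈ P, ∀ Y ∈ P, X ≠ Y → Disjoint (C X).verts (C Y).verts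

/-- `(A, B)` is a separation of the pair `(L, S)`; its order is `(A ∩ B).ncard`. -/
structure IsSeparation {V : Type u} (L : SimpleGraph V) (S A B : Set V) : Prop where
  union_eq : A ∪ B = Set.univ
  not_adj : ∀ a ∈ A \ B, ∀ b ∈ B \ A, ¬ L.Adj a b
  subset_left : S ⊆ A

/-- `(A, B)` is a rigid separation of `(L, S)`: the pair `(L[B], A ∩ B)` is knitted. The degenerate
separations with `B ⊆ A` (for instance `A = V(L)` and `B` empty, which every pair has) are not
counted as rigid. -/
structure IsRigidSeparation {V : Type u} (L : SimpleGraph V) (S A B : Set V) : Prop where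
  isSeparation : IsSeparation L S A B
  nonempty : (B \ A).Nonempty
  knitted : Knitted (L.induce B) {b : B | (b : V) ∈ A ∩ B}

/-- The number of edges of `L` with at least one endpoint in `T`. -/
noncomputable def rho {V : Type u} (L : SimpleGraph V) (T : Set V) : ℕ :=
  {e ∈ L.edgeSet | ∃ v ∈ T, v ∈ e}.ncard

/-- `(L, S)` is `p`-massed. -/
structure Massed {V : Type u} (p : ℕ) (L : SimpleGraph V) (S : Set V) : Prop where
  lt_rho : (p : ℝ) / 2 * (Sᶜ.ncard : ℝ) < (rho L Sᶜ : ℝ)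
  rho_le : ∀ A B : Set V, IsSeparation L S A B → (A ∩ B).ncard + 1 ≤ S.ncard →
    (rho L (B \ A) : ℝ) ≤ (p : ℝ) / 2 * ((B \ A).ncard : ℝ)

/-- The pairs among which minimal ones are chosen: `p`-massed, `|S| ≤ l`, not knitted. -/
structure Admissible {V : Type u} (l p : ℕ) (L : SimpleGraph V) (S : Set V) : Prop where
  massed : Massed p L S
  ncard_le : S.ncard ≤ l
  not_knitted : ¬ Knitted L S

/-- `(L, S)` is `p`-minimal (with respect to `l`): among all admissible pairs `(M, T)`, with `M` a
finite graph, `|V(L)|` is minimum; subject to that, `ρ(V(L) - S)` is minimum; and subject to both,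
the number of edges of `L[S]` is maximum. -/
structure IsMinimalPair {V : Type u} (l p : ℕ) (L : SimpleGraph V) (S : Set V) : Prop where
  le_half : (l : ℤ) ≤ ((p / 2 : ℕ) : ℤ) - 1
  admissible : Admissible l p L S
  card_min : ∀ (W : Type u) [Finite W] (M : SimpleGraph W) (T : Set W), Admissible l p M T →
    Nat.card V ≤ Nat.card W
  rho_min : ∀ (W : Type u) [Finite W] (M : SimpleGraph W) (T : Set W), Admissible l p M T →
    Nat.card W = Nat.card V → rho L Sᶜ ≤ rho M Tᶜ
  edges_max : ∀ (W : Type u) [Finite W] (M : SimpleGraph W) (T : Set W), Admissible l p M T →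
    Nat.card W = Nat.card V → rho M Tᶜ = rho L Sᶜ →
    (M.induce T).edgeSet.ncard ≤ (L.induce S).edgeSet.ncard

open Classical in
/-- The minimum degree of a finite graph. -/
noncomputable def minDeg {W : Type u} [Finite W] (H : SimpleGraph W) : ℕ :=
  letI := Fintype.ofFinite W
  H.minDegree

/-- The vertices of `H` of degree exactly `d`. -/
def verticesOfDegree {W : Type u} (H : SimpleGraph W) (d : ℕ) : Set W :=
  {w | (H.neighborSet w).ncard = d}

/-- The subgraph of `L` induced by the closed neighbourhood `N[v]`. -/
abbrev closedNbhdGraph {V : Type u} (L : SimpleGraph V) (v : V) :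
    SimpleGraph ↥(insert v (L.neighborSet v)) :=
  L.induce (insert v (L.neighborSet v))

end KnittedPairs

/-! By minimality, every massed pair with at most `l` terminals and fewer vertices than `L` is
knitted. Each reduction of `L` is played against this: either it loses too many edges, or a knitted
smaller pair can be lifted back to `L`.

Rigid separations. By Menger's theorem a rigid `(A, B)` yields one of order below `|S|`, since
otherwise `|S|` disjoint paths from `S` to `A ∩ B` would make `(L, S)` knitted. Take one of order
below `|S|` with `|A|` least and turn `A ∩ B` into a clique in `L[A]`. If the result is massed, it
is knitted, and the clique edges can be replaced by paths in `B`. If not, a violating separation has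
the clique on one side; this contradicts massedness of `L` or gives a rigid separation with smaller
left side. Consequently the bound on `rho` extends to separations of order `|S|` with right side not
`V(L)`.

Contraction. For an edge `uv` with `v ∉ S`, contracting `v` into `u` must destroy more than `p/2`
counted edges (`IsMinimalPair.le_ncard_lostVertices`). So at least `⌊p/2⌋` neighbours of `v` are
adjacent to `u` or lie in `S` together with `u`. Moreover, minimality of `rho` gives `2ρ ≤ p|V \ S|
+ 2`, and maximality of `L[S]` makes the non-edges of `S` a matching. Hence `L[N[v]]` has minimum
degree at least `⌊p/2⌋`, with equality only at vertices of `N(v) ∩ S` whose non-neighbour in `S` is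
also in `N(v)`.

Counting. If no `v` satisfies (i)-(iii), then `deg v + |N(v) ∩ S| ≥ p` for every `v ∉ S`. These
numbers sum to `2ρ`, so their total excess over `p` is at most two. Two non-adjacent vertices of `S`
then have almost the same neighbours outside `S`, and enough common ones for Hall's theorem to join
all non-adjacent pairs disjointly. This would make `(L, S)` knitted. -/

namespace KnittedPairs
variable {V : Type u}

/-! ### Walks inside a vertex set -/

/-- `a` and `b` are joined by a walk of `G` all of whose vertices lie in `C`. -/
def JoinedIn (G : SimpleGraph V) (C : Set V) (a b : V) : Prop :=
  ∃ w : G.Walk a b, ∀ x ∈ w.support, x ∈ C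

namespace JoinedIn
variable {G H : SimpleGraph V} {C D : Set V} {a b c : V}

theorem left_mem (h : JoinedIn G C a b) : a ∈ C := by
  obtain ⟨w, hw⟩ := h
  exact hw _ w.start_mem_support

theorem right_mem (h : JoinedIn G C a b) : b ∈ C := by
  obtain ⟨w, hw⟩ := h
  exact hw _ w.end_mem_support

theorem refl (ha : a ∈ C) : JoinedIn G C a a :=
  ⟨.nil, by simpa using ha⟩

theorem symm (h : JoinedIn G C a b) : JoinedIn G C b a := by
  obtain ⟨w, hw⟩ := h
  exact ⟨w.reverse, by simpa using hw⟩

theorem trans (h : JoinedIn G C a b) (h' : JoinedIn G C b c) : JoinedIn G C a c := by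
  obtain ⟨w, hw⟩ := h
  obtain ⟨w', hw'⟩ := h'
  refine ⟨w.append w', fun x hx => ?_⟩
  rw [SimpleGraph.Walk.mem_support_append_iff] at hx
  exact hx.elim (hw x) (hw' x)

theorem of_adj (h : G.Adj a b) (ha : a ∈ C) (hb : b ∈ C) : JoinedIn G C a b :=
  ⟨h.toWalk, by simp [ha, hb]⟩

theorem cons (h : G.Adj a b) (ha : a ∈ C) (h' : JoinedIn G C b c) : JoinedIn G C a c :=
  (of_adj h ha h'.left_mem).trans h'

/-- Induction along a walk inside `C`. -/
theorem induct {motive : V → Prop} (h : JoinedIn G C a b) (nil : b ∈ C → motive b)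
    (cons : ∀ x y, x ∈ C → G.Adj x y → JoinedIn G C y b → motive y → motive x) : motive a := by
  obtain ⟨w, hw⟩ := h
  induction w with
  | nil => exact nil (hw _ (by simp))
  | cons e w ih =>
    exact cons _ _ (hw _ (by simp)) e ⟨w, fun x hx => hw x (by simp [hx])⟩
      (ih nil cons fun x hx => hw x (by simp [hx]))

theorem map_adj (h : JoinedIn G C a b) (hCD : C ⊆ D)
    (hadj : ∀ x ∈ C, ∀ y ∈ C, G.Adj x y → H.Adj x y) : JoinedIn H D a b := by
  refine h.induct (motive := fun x => JoinedIn H D x b) (fun hb => refl (hCD hb))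
    fun x y hx hxy hy ih => ?_
  exact cons (hadj _ hx _ hy.left_mem hxy) (hCD hx) ih

theorem mono (h : JoinedIn G C a b) (hCD : C ⊆ D) : JoinedIn G D a b :=
  h.map_adj hCD fun _ _ _ _ e => e

/-- A walk inside `C` avoids `D` or can be cut at its first vertex in `D`. -/
theorem first_hit (h : JoinedIn G C a b) (D : Set V) :
    JoinedIn G (C \ D) a b ∨ ∃ c ∈ C ∩ D, JoinedIn G (insert c (C \ D)) a c := by
  refine h.induct (motive := fun x => JoinedIn G (C \ D) x b ∨
    ∃ c ∈ C ∩ D, JoinedIn G (insert c (C \ D)) x c) (fun hb => ?_) fun x y hx hxy _ ih => ?_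
  · by_cases hD : b ∈ D
    · exact .inr ⟨b, ⟨hb, hD⟩, refl (by simp)⟩
    · exact .inl (refl ⟨hb, hD⟩)
  · by_cases hD : x ∈ D
    · exact .inr ⟨x, ⟨hx, hD⟩, refl (by simp)⟩
    · rcases ih with ih | ⟨c, hc, ih⟩
      · exact .inl (ih.cons hxy ⟨hx, hD⟩)
      · exact .inr ⟨c, hc, ih.cons hxy (.inr ⟨hx, hD⟩)⟩

/-- A set that is closed under adjacency inside `C` contains the end of each walk in `C` that
starts in it. -/
theorem mem_of_closed (h : JoinedIn G C a b) {R : Set V} (ha : a ∈ R)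
    (hR : ∀ x ∈ R, ∀ y ∈ C, G.Adj x y → y ∈ R) : b ∈ R := by
  have key : a ∈ R → b ∈ R :=
    h.induct (motive := fun x => x ∈ R → b ∈ R) (fun _ hb => hb)
      fun x y _ hxy hy ih hx => ih (hR x hx y hy.left_mem hxy)
  exact key ha

theorem map {W : Type u} {M : SimpleGraph W} (φ : M →g G) {C : Set W} {a b : W}
    (h : JoinedIn M C a b) : JoinedIn G (φ '' C) (φ a) (φ b) := by
  refine h.induct (motive := fun x => JoinedIn G (φ '' C) (φ x) (φ b))
    (fun hb => refl ⟨b, hb, rfl⟩) fun x y hx hxy _ ih => ?_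
  exact cons (φ.map_adj hxy) ⟨x, hx, rfl⟩ ih

theorem comap {W : Type u} {M : SimpleGraph W} (φ : M ↪g G) {C : Set V} (hC : C ⊆ Set.range φ)
    {a b : W} (h : JoinedIn G C (φ a) (φ b)) : JoinedIn M (φ ⁻¹' C) a b := by
  refine h.induct (motive := fun x => ∀ z, φ z = x → JoinedIn M (φ ⁻¹' C) z b) ?_ ?_ a rfl
  · intro hb z hz
    obtain rfl := φ.injective hz
    exact refl hb
  · rintro x y hx hxy hy ih z rfl
    obtain ⟨z', rfl⟩ := hC hy.left_mem
    exact cons (φ.map_adj_iff.1 hxy) hx (ih z' rfl)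

end JoinedIn

/-! ### Knittedness through disjoint vertex sets of an ambient graph -/

/-- `(G[X], T)` is knitted, expressed by families of vertex sets of `G`. -/
def KnittedOn (G : SimpleGraph V) (X T : Set V) : Prop :=
  ∀ (ι : Type u) (s t : ι → V), (∀ i, s i ∈ T) → (∀ i, t i ∈ T) →
    (Pairwise fun i j => Disjoint ({s i, t i} : Set V) {s j, t j}) →
    ∃ C : ι → Set V, (∀ i, C i ⊆ X) ∧ (Pairwise fun i j => Disjoint (C i) (C j)) ∧
      (∀ i, JoinedIn G (C i) (s i) (t i)) ∧ ∀ i, C i ∩ T ⊆ {s i, t i}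

theorem exists_eq_pair {X : Set V} (h : X.ncard = 1 ∨ X.ncard = 2) : ∃ a b, X = {a, b} := by
  rcases h with h | h
  · obtain ⟨a, rfl⟩ := Set.ncard_eq_one.1 h
    exact ⟨a, a, by simp⟩
  · obtain ⟨a, b, -, rfl⟩ := Set.ncard_eq_two.1 h
    exact ⟨a, b, rfl⟩

theorem ncard_pair_eq (a b : V) : ({a, b} : Set V).ncard = 1 ∨ ({a, b} : Set V).ncard = 2 := by
  by_cases h : a = b
  · simp [h]
  · exact .inr (Set.ncard_pair h)

/-- The family of the pairs `{s i, t i}` together with the remaining singletons of `T`. -/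
theorem exists_partition {ι : Type u} {T : Set V} {s t : ι → V} (hs : ∀ i, s i ∈ T)
    (ht : ∀ i, t i ∈ T) (hst : Pairwise fun i j => Disjoint ({s i, t i} : Set V) {s j, t j}) :
    ∃ P : Set (Set V), P.PairwiseDisjoint id ∧ ⋃₀ P = T ∧
      (∀ X ∈ P, X.ncard = 1 ∨ X.ncard = 2) ∧ ∀ i, {s i, t i} ∈ P := by
  refine ⟨Set.range (fun i => ({s i, t i} : Set V)) ∪
    {X | ∃ x ∈ T, (∀ i, x ≠ s i ∧ x ≠ t i) ∧ X = {x}}, ?_, ?_, ?_, fun i => .inl ⟨i, rfl⟩⟩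
  · rintro _ (⟨i, rfl⟩ | ⟨x, hx, hx', rfl⟩) _ (⟨j, rfl⟩ | ⟨y, hy, hy', rfl⟩) hne
    · exact hst fun h => hne (by simp [h])
    · simp only [Function.onFun, id, Set.disjoint_singleton_right]
      simpa using hy' i
    · simp only [Function.onFun, id, Set.disjoint_singleton_left]
      simpa using hx' j
    · simp only [Function.onFun, id, Set.disjoint_singleton]
      rintro rfl
      exact hne rfl
  · ext x
    constructor
    · rintro ⟨_, ⟨i, rfl⟩ | ⟨y, hy, -, rfl⟩, hx⟩
      · rcases hx with rfl | rfl
        exacts [hs i, ht i]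
      · rwa [Set.mem_singleton_iff.1 hx]
    · intro hx
      by_cases h : ∃ i, x = s i ∨ x = t i
      · obtain ⟨i, hi⟩ := h
        exact ⟨_, .inl ⟨i, rfl⟩, by simpa using hi⟩
      · push Not at h
        exact ⟨{x}, .inr ⟨x, hx, h, rfl⟩, rfl⟩
  · rintro _ (⟨i, rfl⟩ | ⟨y, hy, -, rfl⟩)
    · exact ncard_pair_eq _ _
    · simp

/-- The pairs are completed to a partition by singletons. The subgraphs of the other parts occupy
the remaining terminals, which yields the last clause of `KnittedOn`: no set contains a foreign
terminal. -/
theorem knittedOn_of_knitted {W : Type u} {M : SimpleGraph W} {G : SimpleGraph V} (φ : M ↪g G)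
    {T : Set W} (h : Knitted M T) : KnittedOn G (Set.range φ) (φ '' T) := by
  intro ι s t hs ht hst
  choose s' hs' hs using hs
  choose t' ht' ht using ht
  obtain rfl : (fun i => φ (s' i)) = s := funext hs
  obtain rfl : (fun i => φ (t' i)) = t := funext ht
  have hst' : Pairwise fun i j => Disjoint ({s' i, t' i} : Set W) {s' j, t' j} := by
    intro i j hij
    have := hst hij
    simpa [φ.injective.eq_iff] using this
  obtain ⟨P, hP, hPT, hPc, hmem⟩ := exists_partition hs' ht' hst'
  obtain ⟨C, hC, hCd⟩ := h P hP hPT hPc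
  have hne : ∀ i j, i ≠ j → ({s' i, t' i} : Set W) ≠ {s' j, t' j} := by
    intro i j hij heq
    have : Disjoint ({s' i, t' i} : Set W) {s' j, t' j} := hst' hij
    rw [heq, disjoint_self] at this
    exact (Set.insert_nonempty _ _).ne_empty this
  refine ⟨fun i => φ '' (C {s' i, t' i}).verts, fun i => Set.image_subset_range _ _, ?_, ?_, ?_⟩
  · intro i j hij
    exact (Set.disjoint_image_iff φ.injective).2 (hCd _ (hmem i) _ (hmem j) (hne i j hij))
  · intro i
    refine JoinedIn.map φ.toHom ?_
    obtain ⟨hsub, hcon⟩ := hC _ (hmem i)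
    obtain ⟨w, hw⟩ := ((C {s' i, t' i}).preconnected_iff_forall_exists_walk_subgraph.1
      hcon.preconnected) (hsub (.inl rfl)) (hsub (.inr rfl))
    refine ⟨w, fun x hx => hw.1 ?_⟩
    simpa using hx
  · rintro i _ ⟨⟨x, hx, rfl⟩, y, hy, hxy⟩
    obtain rfl := φ.injective hxy
    rw [← hPT] at hy
    obtain ⟨Y, hY, hyY⟩ := hy
    by_cases hYi : Y = {s' i, t' i}
    · subst hYi
      simpa [φ.injective.eq_iff] using hyY
    · exact absurd hx (Set.disjoint_left.1 (hCd Y hY _ (hmem i) hYi) ((hC Y hY).1 hyY))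

theorem knitted_of_knittedOn {W : Type u} {M : SimpleGraph W} {G : SimpleGraph V} (φ : M ↪g G)
    {T : Set W} (h : KnittedOn G (Set.range φ) (φ '' T)) : Knitted M T := by
  classical
  intro P hP hPT hPc
  have hpair : ∀ X : P, ∃ a b, (X : Set W) = {a, b} := fun X => exists_eq_pair (hPc X X.2)
  choose s t hst using hpair
  have hs : ∀ X, s X ∈ T := fun X => hPT ▸ ⟨X, X.2, by rw [hst X]; simp⟩
  have ht : ∀ X, t X ∈ T := fun X => hPT ▸ ⟨X, X.2, by rw [hst X]; simp⟩
  obtain ⟨C, hCX, hCd, hCj, -⟩ := h P (fun X => φ (s X)) (fun X => φ (t X))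
    (fun X => ⟨_, hs X, rfl⟩) (fun X => ⟨_, ht X, rfl⟩) (by
      intro X Y hXY
      have h1 : Disjoint (X : Set W) Y := hP X.2 Y.2 fun h => hXY (Subtype.ext h)
      rw [hst X, hst Y] at h1
      simpa [φ.injective.eq_iff] using h1)
  choose w hw using fun X => (hCj X).comap φ (hCX X)
  refine ⟨fun X => if hX : X ∈ P then (w ⟨X, hX⟩).toSubgraph else ⊥, fun X hX => ?_,
    fun X hX Y hY hXY => ?_⟩
  · simp only [hX, dif_pos]
    refine ⟨?_, (w ⟨X, hX⟩).toSubgraph_connected⟩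
    have := hst ⟨X, hX⟩
    simp only at this
    intro x hx
    rw [this] at hx
    rw [SimpleGraph.Walk.mem_verts_toSubgraph]
    rcases hx with rfl | rfl
    · exact (w ⟨X, hX⟩).start_mem_support
    · exact (w ⟨X, hX⟩).end_mem_support
  · simp only [hX, hY, dif_pos]
    rw [Set.disjoint_left]
    intro x hx hx'
    rw [SimpleGraph.Walk.mem_verts_toSubgraph] at hx hx'
    refine Set.disjoint_left.1 (hCd (i := ⟨X, hX⟩) (j := ⟨Y, hY⟩) fun h => hXY ?_)
      (hw _ x hx) (hw _ x hx')
    exact congrArg Subtype.val h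

theorem knitted_iff_knittedOn_univ {L : SimpleGraph V} {S : Set V} :
    Knitted L S ↔ KnittedOn L Set.univ S := by
  have h1 : Set.range (SimpleGraph.Embedding.refl : L ↪g L) = Set.univ :=
    Set.range_eq_univ.2 fun x => ⟨x, rfl⟩
  have h2 : (SimpleGraph.Embedding.refl : L ↪g L) '' S = S := Set.image_id S
  constructor
  · intro h
    have := knittedOn_of_knitted (SimpleGraph.Embedding.refl : L ↪g L) h
    rwa [h1, h2] at this
  · intro h
    apply knitted_of_knittedOn (SimpleGraph.Embedding.refl : L ↪g L)
    rwa [h1, h2]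

theorem knitted_induce_iff {G : SimpleGraph V} {X T : Set V} (hTX : T ⊆ X) :
    Knitted (G.induce X) {b : X | (b : V) ∈ T} ↔ KnittedOn G X T := by
  have h1 : Set.range (SimpleGraph.Embedding.induce (G := G) X) = X := Subtype.range_coe
  have h2 : (SimpleGraph.Embedding.induce (G := G) X) '' {b : X | (b : V) ∈ T} = T := by
    ext x
    constructor
    · rintro ⟨y, hy, rfl⟩
      exact hy
    · intro hx
      exact ⟨⟨x, hTX hx⟩, hx, rfl⟩
  constructor
  · intro h
    have := knittedOn_of_knitted (SimpleGraph.Embedding.induce (G := G) X) h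
    rwa [h1, h2] at this
  · intro h
    apply knitted_of_knittedOn (SimpleGraph.Embedding.induce (G := G) X)
    rwa [h1, h2]

/-! ### Separations and massed pairs inside an ambient graph -/

/-- `(C, D)` is a separation of `(G[X], T)`. -/
structure SepOn (G : SimpleGraph V) (X T C D : Set V) : Prop where
  union_eq : C ∪ D = X
  not_adj : ∀ a ∈ C \ D, ∀ b ∈ D \ C, ¬ G.Adj a b
  subset_left : T ⊆ C

theorem isSeparation_iff_sepOn_univ {L : SimpleGraph V} {S A B : Set V} :
    IsSeparation L S A B ↔ SepOn L Set.univ S A B :=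
  ⟨fun h => ⟨h.1, h.2, h.3⟩, fun h => ⟨h.1, h.2, h.3⟩⟩

/-- `(G[X], T)` is `p`-massed, provided that all neighbours of `X \ T` lie in `X`. -/
structure MassedOn (p : ℕ) (G : SimpleGraph V) (X T : Set V) : Prop where
  lt_rho : p * (X \ T).ncard < 2 * rho G (X \ T)
  rho_le : ∀ C D : Set V, SepOn G X T C D → (C ∩ D).ncard < T.ncard →
    2 * rho G (D \ C) ≤ p * (D \ C).ncard

theorem half_mul_lt_iff {p a b : ℕ} : (p : ℝ) / 2 * (a : ℝ) < (b : ℝ) ↔ p * a < 2 * b := by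
  rw [← Nat.cast_lt (α := ℝ)]
  push_cast
  constructor <;> intro h <;> linarith

theorem le_half_mul_iff {p a b : ℕ} : (b : ℝ) ≤ (p : ℝ) / 2 * (a : ℝ) ↔ 2 * b ≤ p * a := by
  rw [← not_lt, half_mul_lt_iff, not_lt]

theorem massed_iff_massedOn_univ {p : ℕ} {L : SimpleGraph V} {S : Set V} :
    Massed p L S ↔ MassedOn p L Set.univ S := by
  constructor
  · rintro ⟨h1, h2⟩
    refine ⟨?_, fun C D h hlt => ?_⟩
    · rwa [half_mul_lt_iff, Set.compl_eq_univ_sdiff] at h1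
    · exact le_half_mul_iff.1 (h2 C D (isSeparation_iff_sepOn_univ.2 h) hlt)
  · rintro ⟨h1, h2⟩
    refine ⟨?_, fun C D h hlt => ?_⟩
    · rwa [half_mul_lt_iff, Set.compl_eq_univ_sdiff]
    · exact le_half_mul_iff.2 (h2 C D (isSeparation_iff_sepOn_univ.1 h) hlt)

theorem rho_induce {G : SimpleGraph V} {X Y : Set V} (hYX : Y ⊆ X)
    (hcl : ∀ x ∈ Y, ∀ y, G.Adj x y → y ∈ X) :
    rho (G.induce X) ((↑) ⁻¹' Y : Set X) = rho G Y := by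
  unfold rho
  rw [← Set.ncard_image_of_injective _ (Sym2.map.injective (Subtype.val_injective (p := (· ∈ X))))]
  congr 1
  ext e
  constructor
  · rintro ⟨e', ⟨he', v, hv, hve⟩, rfl⟩
    induction e' with
    | h a b =>
      exact ⟨by simpa using he', v, hv, by
        rw [Sym2.mem_map]
        exact ⟨v, hve, rfl⟩⟩
  · rintro ⟨he, v, hv, hve⟩
    obtain ⟨w, rfl⟩ := Sym2.mem_iff_exists.1 hve
    have hvw : G.Adj v w := he
    exact ⟨s(⟨v, hYX hv⟩, ⟨w, hcl v hv w hvw⟩), ⟨hvw, ⟨v, hYX hv⟩, hv, by simp⟩, by simp⟩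

theorem ncard_preimage_coe {X Y : Set V} (hYX : Y ⊆ X) :
    ((↑) ⁻¹' Y : Set X).ncard = Y.ncard := by
  rw [← Set.ncard_image_of_injective _ Subtype.val_injective, Subtype.image_preimage_coe,
    Set.inter_eq_right.2 hYX]

/-- The closure hypothesis `hcl` ensures that no edge counted by `rho` is lost on passing to `G[X]`.
-/
theorem MassedOn.massed_induce {p : ℕ} {G : SimpleGraph V} {X T : Set V} (h : MassedOn p G X T)
    (hTX : T ⊆ X) (hcl : ∀ x ∈ X \ T, ∀ y, G.Adj x y → y ∈ X) :
    Massed p (G.induce X) {b : X | (b : V) ∈ T} := by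
  rw [massed_iff_massedOn_univ]
  have himg : ∀ Z : Set X, Z = (↑) ⁻¹' ((↑) '' Z : Set V) := fun Z =>
    (Set.preimage_image_eq _ Subtype.val_injective).symm
  refine ⟨?_, fun C D hCD hlt => ?_⟩
  · have h1 : (Set.univ \ {b : X | (b : V) ∈ T}) = (↑) ⁻¹' (X \ T) := by
      ext x
      simp
    rw [h1, rho_induce Set.sdiff_subset hcl, ncard_preimage_coe Set.sdiff_subset]
    exact h.lt_rho
  · have hsub : ((↑) '' D : Set V) \ ((↑) '' C) ⊆ X \ T := by
      rintro _ ⟨⟨x, hx, rfl⟩, hx'⟩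
      exact ⟨x.2, fun hT => hx' ⟨x, hCD.subset_left hT, rfl⟩⟩
    have h1 : D \ C = (↑) ⁻¹' (((↑) '' D : Set V) \ ((↑) '' C)) := by
      rw [Set.preimage_sdiff, ← himg, ← himg]
    rw [h1, rho_induce (hsub.trans Set.sdiff_subset) fun x hx => hcl x (hsub hx),
      ncard_preimage_coe (hsub.trans Set.sdiff_subset)]
    apply h.rho_le
    · refine ⟨?_, ?_, ?_⟩
      · rw [← Set.image_union, hCD.union_eq]
        simp
      · rintro _ ⟨⟨a, ha, rfl⟩, ha'⟩ _ ⟨⟨b, hb, rfl⟩, hb'⟩ hab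
        exact hCD.not_adj a ⟨ha, fun h => ha' ⟨a, h, rfl⟩⟩ b ⟨hb, fun h => hb' ⟨b, h, rfl⟩⟩ hab
      · intro x hx
        exact ⟨⟨x, hTX hx⟩, hCD.subset_left hx, rfl⟩
    · rw [← Set.image_inter Subtype.val_injective,
        Set.ncard_image_of_injective _ Subtype.val_injective]
      have := ncard_preimage_coe hTX
      rw [← this]
      exact hlt

/-- Massed pairs that are smaller than a minimal pair are knitted. -/
theorem IsMinimalPair.knittedOn [Finite V] {l p : ℕ} {L : SimpleGraph V} {S : Set V}
    (hmin : IsMinimalPair l p L S) {G : SimpleGraph V} {X T : Set V} (hX : X ≠ Set.univ)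
    (hTX : T ⊆ X) (hcl : ∀ x ∈ X \ T, ∀ y, G.Adj x y → y ∈ X) (hT : T.ncard ≤ l)
    (h : MassedOn p G X T) : KnittedOn G X T := by
  rw [← knitted_induce_iff hTX]
  by_contra hk
  have := hmin.card_min X (G.induce X) {b : X | (b : V) ∈ T} ⟨h.massed_induce hTX hcl, by
    have := ncard_preimage_coe hTX
    change (((↑) ⁻¹' T : Set X)).ncard ≤ l
    omega, hk⟩
  have hlt := Set.ncard_lt_card hX
  rw [← Nat.card_coe_set_eq] at hlt
  omega

/-! ### Menger's theorem -/

/-- A walk inside `C` avoids `D` or can be cut at its first vertex `c` in `D`, and then the vertices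
before `c` are reached without meeting `D`. -/
theorem JoinedIn.trim {G : SimpleGraph V} {C : Set V} {a b : V} (h : JoinedIn G C a b)
    (D : Set V) : JoinedIn G (C \ D) a b ∨ ∃ c ∈ D, ∃ C' ⊆ C, C' ∩ D ⊆ {c} ∧ JoinedIn G C' a c ∧
      ∀ z ∈ C', z ≠ c → JoinedIn G (C \ D) a z := by
  refine h.induct (motive := fun x => JoinedIn G (C \ D) x b ∨
    ∃ c ∈ D, ∃ C' ⊆ C, C' ∩ D ⊆ {c} ∧ JoinedIn G C' x c ∧
      ∀ z ∈ C', z ≠ c → JoinedIn G (C \ D) x z) (fun hb => ?_) fun x y hx hxy _ ih => ?_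
  · by_cases hD : b ∈ D
    · exact .inr ⟨b, hD, {b}, by simpa using hb, by simp, refl rfl, fun z hz hzb => absurd hz hzb⟩
    · exact .inl (refl ⟨hb, hD⟩)
  · by_cases hD : x ∈ D
    · exact .inr ⟨x, hD, {x}, by simpa using hx, by simp, refl rfl, fun z hz hzb => absurd hz hzb⟩
    · rcases ih with ih | ⟨c, hc, C', hC', hCD, hj, hz⟩
      · exact .inl (ih.cons hxy ⟨hx, hD⟩)
      · refine .inr ⟨c, hc, insert x C', Set.insert_subset hx hC', ?_,
          (hj.mono (Set.subset_insert _ _)).cons hxy (.inl rfl), ?_⟩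
        · rintro z ⟨rfl | hz, hzD⟩
          · exact absurd hzD hD
          · exact hCD ⟨hz, hzD⟩
        · rintro z (rfl | hzC) hzc
          · exact refl ⟨hx, hD⟩
          · exact (hz z hzC hzc).cons hxy ⟨hx, hD⟩

/-- `Y` meets every walk of `G` from `A` to `B`. -/
def Separates (G : SimpleGraph V) (A B Y : Set V) : Prop :=
  ∀ a ∈ A, ∀ b ∈ B, ¬ JoinedIn G Yᶜ a b

/-- There are `k` pairwise disjoint walks of `G` from `A` to `B`. -/
def Linkage (G : SimpleGraph V) (A B : Set V) (k : ℕ) : Prop :=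
  ∃ (C : Fin k → Set V) (s t : Fin k → V), (∀ i, s i ∈ A) ∧ (∀ i, t i ∈ B) ∧
    (Pairwise fun i j => Disjoint (C i) (C j)) ∧ ∀ i, JoinedIn G (C i) (s i) (t i)

theorem Linkage.symm {G : SimpleGraph V} {A B : Set V} {k : ℕ} (h : Linkage G A B k) :
    Linkage G B A k := by
  obtain ⟨C, s, t, hs, ht, hd, hj⟩ := h
  exact ⟨C, t, s, ht, hs, hd, fun i => (hj i).symm⟩

/-- The walks of a linkage can be cut at their first vertices in `B`. -/
theorem Linkage.trim {G : SimpleGraph V} {A B : Set V} {k : ℕ} (h : Linkage G A B k) :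
    ∃ (C : Fin k → Set V) (s t : Fin k → V), (∀ i, s i ∈ A) ∧ (∀ i, t i ∈ B) ∧
      (Pairwise fun i j => Disjoint (C i) (C j)) ∧ (∀ i, JoinedIn G (C i) (s i) (t i)) ∧
      (∀ i, C i ∩ B ⊆ {t i}) ∧ ∀ i, ∀ z ∈ C i, z ≠ t i → JoinedIn G Bᶜ (s i) z := by
  obtain ⟨C, s, t, hs, ht, hd, hj⟩ := h
  have := fun i => ((hj i).trim B).resolve_left fun h => h.right_mem.2 (ht i)
  choose c hc C' hC' hCB hj' hz using this
  exact ⟨C', s, c, hs, hc, fun i j hij => (hd hij).mono (hC' i) (hC' j), hj', hCB,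
    fun i z hzC hzc => (hz i z hzC hzc).mono fun x hx => hx.2⟩

theorem injective_of_pairwise_disjoint {ι : Type*} {C : ι → Set V} {s : ι → V}
    (hd : Pairwise fun i j => Disjoint (C i) (C j)) (hs : ∀ i, s i ∈ C i) :
    Function.Injective s := by
  intro i j hij
  by_contra hne
  exact Set.disjoint_left.1 (hd hne) (hs i) (hij ▸ hs j)

theorem exists_eq_of_injective [Finite V] {k : ℕ} {Y : Set V} (hY : Y.ncard = k) {t : Fin k → V}
    (ht : ∀ i, t i ∈ Y) (hinj : Function.Injective t) {y : V} (hy : y ∈ Y) : ∃ i, t i = y := by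
  have h1 : Set.range t = Y := by
    apply Set.eq_of_subset_of_ncard_le (Set.range_subset_iff.2 ht)
    rw [hY, ← Set.image_univ, Set.ncard_image_of_injective _ hinj]
    simp
  rw [← h1] at hy
  exact hy

/-- Cut at their first hits, the walks from `A` stay in `R` before their ends and those from `B`
stay outside `R`. So the two linkages meet only in `Y`, where they are spliced; the remaining two
walks are joined by the edge `xy`. -/
theorem Linkage.glue [Finite V] {k : ℕ} {G H : SimpleGraph V} {A B Y R : Set V} {x y : V}
    (hxy : G.Adj x y) (hHG : H ≤ G) (hYy : (insert y Y).ncard = k)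
    (hxR : x ∈ R) (hyR : y ∉ R) (hyY : y ∉ Y) (hYR : Disjoint Y R)
    (hA : ∀ a ∈ A, ∀ z, JoinedIn H (insert x Y)ᶜ a z → z ∈ R)
    (hB : ∀ b ∈ B, ∀ z, JoinedIn H (insert y Y)ᶜ b z → z ∉ R)
    (h1 : Linkage H A (insert x Y) k) (h2 : Linkage H (insert y Y) B k) : Linkage G A B k := by
  obtain ⟨C, s, t, hs, ht, hd, hj, -, hC⟩ := h1.trim
  obtain ⟨C', t', s', ht', hs', hd', hj', hCB', hC'⟩ := h2.symm.trim
  have htinj : Function.Injective t := injective_of_pairwise_disjoint hd fun i => (hj i).right_mem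
  have hsinj : Function.Injective s' := injective_of_pairwise_disjoint hd' fun i => (hj' i).right_mem
  have hex : ∀ i, ∃ j, t i ∈ Y ∧ s' j = t i ∨ t i = x ∧ s' j = y := by
    intro i
    rcases ht i with h | h
    · obtain ⟨j, hj⟩ := exists_eq_of_injective hYy hs' hsinj (Set.mem_insert y Y)
      exact ⟨j, .inr ⟨h, hj⟩⟩
    · obtain ⟨j, hj⟩ := exists_eq_of_injective hYy hs' hsinj (Set.mem_insert_of_mem y h)
      exact ⟨j, .inl ⟨h, hj⟩⟩
  choose j hjt using hex
  have hjinj : Function.Injective j := by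
    intro i i' hii
    apply htinj
    have h := hjt i
    have h' := hjt i'
    rw [← hii] at h'
    rcases h with ⟨h, e⟩ | ⟨h, e⟩ <;> rcases h' with ⟨h', e'⟩ | ⟨h', e'⟩
    · exact e.symm.trans e'
    · exact absurd (e' ▸ e ▸ h) hyY
    · exact absurd (e ▸ e' ▸ h') hyY
    · exact h.trans h'.symm
  have hcross : ∀ i i', i ≠ i' → Disjoint (C i) (C' (j i')) := by
    intro i i' hne
    rw [Set.disjoint_left]
    intro z hz hz'
    have hzR : z ∉ R := by
      by_cases hzs : z = s' (j i')
      · rcases hs' (j i') with h | h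
        · rwa [hzs, h]
        · exact hzs ▸ Set.disjoint_left.1 hYR h
      · exact hB _ (ht' _) z (hC' _ z hz' hzs)
    have hzt : z = t i := by
      by_contra hzt
      exact hzR (hA _ (hs i) z (hC i z hz hzt))
    have hzY : z ∈ Y := by
      rcases ht i with h | h
      · exact absurd (hzt.trans h ▸ hxR) hzR
      · exact hzt ▸ h
    have hzs : z = s' (j i') := hCB' _ ⟨hz', Set.mem_insert_of_mem _ hzY⟩
    rcases hjt i' with ⟨-, e⟩ | ⟨-, e⟩
    · exact hne (htinj (hzt.symm.trans (hzs.trans e)))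
    · exact hyY (e ▸ hzs ▸ hzY)
  refine ⟨fun i => C i ∪ C' (j i), s, fun i => t' (j i), hs, fun i => ht' _, ?_, fun i => ?_⟩
  · intro i i' hne
    simp only [Set.disjoint_union_left, Set.disjoint_union_right]
    exact ⟨⟨hd hne, (hcross i' i hne.symm).symm⟩, hcross i i' hne, hd' (hjinj.ne hne)⟩
  · have e1 : JoinedIn G (C i ∪ C' (j i)) (s i) (t i) :=
      (hj i).map_adj Set.subset_union_left fun _ _ _ _ e => hHG e
    have e2 : JoinedIn G (C i ∪ C' (j i)) (s' (j i)) (t' (j i)) :=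
      (hj' (j i)).symm.map_adj Set.subset_union_right fun _ _ _ _ e => hHG e
    refine e1.trans ?_
    rcases hjt i with ⟨-, e⟩ | ⟨e, e'⟩
    · rwa [← e]
    · rw [e] at e1 ⊢
      rw [e'] at e2
      exact e2.cons hxy e1.right_mem

/-- The separator `Y` of `G - xy` has exactly `k - 1` vertices, because adding `x` to it separates
in `G`. Any set separating `A` from `Y + x`, or `Y + y` from `B`, in `G - xy` also separates `A`
from `B` in `G`, so both halves have linkages of size `k`. -/
theorem Linkage.of_delete_edge [Finite V] {k : ℕ} {G H : SimpleGraph V} {A B Y : Set V} {x y : V}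
    (hxy : G.Adj x y) (hHG : ∀ a b, H.Adj a b ↔ G.Adj a b ∧ s(a, b) ≠ s(x, y))
    (hsep : ∀ Z, Separates G A B Z → k ≤ Z.ncard) (hY : Separates H A B Y) (hYk : Y.ncard < k)
    (hx : ∃ a ∈ A, JoinedIn H Yᶜ a x) (hy : ¬ ∃ a ∈ A, JoinedIn H Yᶜ a y)
    (ih : ∀ A B : Set V, (∀ Z, Separates H A B Z → k ≤ Z.ncard) → Linkage H A B k) :
    Linkage G A B k := by
  set R : Set V := {z | ∃ a ∈ A, JoinedIn H Yᶜ a z} with hR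
  have hYR : Disjoint Y R := Set.disjoint_right.2 fun z ⟨a, _, h⟩ => h.right_mem
  have hRB : ∀ b ∈ B, b ∉ R := fun b hb ⟨a, ha, h⟩ => hY a ha b hb h
  have hH : ∀ {D : Set V} {a b : V}, x ∉ D ∨ y ∉ D → JoinedIn G D a b → JoinedIn H D a b := by
    intro D a b hD h
    refine h.map_adj subset_rfl fun p hp q hq e => (hHG p q).2 ⟨e, fun heq => ?_⟩
    rw [Sym2.eq_iff] at heq
    rcases heq with ⟨rfl, rfl⟩ | ⟨rfl, rfl⟩ <;> tauto
  have hyY : y ∉ Y := fun h => by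
    refine absurd (hsep Y fun a ha b hb hab => ?_) (not_le.2 hYk)
    exact hY a ha b hb (hH (.inr fun h' => h' h) hab)
  have hxY : x ∉ Y := by
    obtain ⟨a, -, h⟩ := hx
    exact h.right_mem
  have hxc : (insert x Y)ᶜ ⊆ Yᶜ := Set.compl_subset_compl.2 (Set.subset_insert _ _)
  have hyc : (insert y Y)ᶜ ⊆ Yᶜ := Set.compl_subset_compl.2 (Set.subset_insert _ _)
  have hk : Y.ncard + 1 = k := by
    have := hsep (insert x Y) fun a ha b hb hab =>
      hY a ha b hb ((hH (.inl (by simp)) hab).mono hxc)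
    rw [Set.ncard_insert_of_notMem hxY] at this
    omega
  have hyx : y ≠ x := hxy.ne'
  refine Linkage.glue (R := R) hxy (fun a b h => ((hHG a b).1 h).1)
    (by rw [Set.ncard_insert_of_notMem hyY, hk])
    hx hy hyY hYR (fun a ha z h => ⟨a, ha, h.mono hxc⟩) ?_ (ih _ _ ?_) (ih _ _ ?_)
  · rintro b hb z h ⟨a, ha, h'⟩
    exact hY a ha b hb (h'.trans (h.mono hyc).symm)
  · intro Z hZ
    refine hsep Z fun a ha b hb hab => ?_
    have hsub : Zᶜ \ insert x Y ⊆ (insert x Y)ᶜ := fun z hz => hz.2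
    rcases hab.trim (insert x Y) with h | ⟨c, hc, C', hC', hCD, hj, hz⟩
    · exact hY a ha b hb ((hH (.inl (by simp)) (h.mono hsub)).mono hxc)
    · refine hZ a ha c hc ((hH ?_ hj).mono hC')
      by_contra! hcon
      have hxc' : x = c := hCD ⟨hcon.1, .inl rfl⟩
      exact hy ⟨a, ha, (hH (.inl (by simp)) ((hz y hcon.2 (hxc' ▸ hyx)).mono hsub)).mono hxc⟩
  · intro Z hZ
    refine hsep Z fun a ha b hb hab => ?_
    have hsub : Zᶜ \ insert y Y ⊆ (insert y Y)ᶜ := fun z hz => hz.2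
    rcases hab.symm.trim (insert y Y) with h | ⟨c, hc, C', hC', hCD, hj, hz⟩
    · exact hY a ha b hb ((hH (.inr (by simp)) (h.mono hsub)).mono hyc).symm
    · refine hZ c hc b hb ((hH ?_ hj).mono hC').symm
      by_contra! hcon
      have hyc' : y = c := hCD ⟨hcon.2, .inl rfl⟩
      obtain ⟨a', ha', h'⟩ := hx
      have := (hH (.inr (by simp)) ((hz x hcon.1 (hyc' ▸ hyx.symm)).mono hsub)).mono hyc
      exact hY a' ha' b hb (h'.trans this.symm)

/-- Menger's theorem. -/
theorem linkage_of_separates [Finite V] {k : ℕ} (G : SimpleGraph V) (A B : Set V)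
    (hsep : ∀ Z, Separates G A B Z → k ≤ Z.ncard) : Linkage G A B k := by
  induction hn : G.edgeSet.ncard using Nat.strong_induction_on generalizing G A B with
  | _ n ih =>
    by_cases hG : ∃ x y, G.Adj x y
    · obtain ⟨x, y, hxy⟩ := hG
      set H := G.deleteEdges {s(x, y)} with hHdef
      have hHG : ∀ a b, H.Adj a b ↔ G.Adj a b ∧ s(a, b) ≠ s(x, y) := by
        intro a b
        simp [hHdef, SimpleGraph.deleteEdges_adj]
      have hlt : H.edgeSet.ncard < n := by
        rw [← hn]
        apply Set.ncard_lt_ncard _ (Set.toFinite _)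
        rw [hHdef, SimpleGraph.edgeSet_deleteEdges]
        exact ⟨Set.sdiff_subset, fun h => (h (show s(x, y) ∈ G.edgeSet from hxy)).2 rfl⟩
      have ihH := fun A B hs => ih _ hlt H A B hs rfl
      by_cases hHsep : ∀ Z, Separates H A B Z → k ≤ Z.ncard
      · obtain ⟨C, s, t, hs, ht, hd, hj⟩ := ihH A B hHsep
        exact ⟨C, s, t, hs, ht, hd, fun i => (hj i).map_adj subset_rfl
          fun _ _ _ _ e => ((hHG _ _).1 e).1⟩
      · push Not at hHsep
        obtain ⟨Y, hY, hYk⟩ := hHsep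
        -- Otherwise the edge `xy` would not leave the set reached from `A`, and `Y`, with fewer
        -- than `k` vertices, would separate in `G` as well.
        have hclosed : ¬((∃ a ∈ A, JoinedIn H Yᶜ a x) ↔ ∃ a ∈ A, JoinedIn H Yᶜ a y) := by
          intro hiff
          refine absurd (hsep Y fun a ha b hb hab => ?_) (not_le.2 hYk)
          obtain ⟨a', ha', h⟩ := hab.mem_of_closed (R := {z | ∃ a ∈ A, JoinedIn H Yᶜ a z})
            ⟨a, ha, JoinedIn.refl hab.left_mem⟩ (by
              rintro p ⟨a', ha', hp⟩ q hq hpq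
              by_cases heq : s(p, q) = s(x, y)
              · rw [Sym2.eq_iff] at heq
                rcases heq with ⟨rfl, rfl⟩ | ⟨rfl, rfl⟩
                · exact hiff.1 ⟨a', ha', hp⟩
                · exact hiff.2 ⟨a', ha', hp⟩
              · exact ⟨a', ha', hp.trans (.of_adj ((hHG _ _).2 ⟨hpq, heq⟩) hp.right_mem hq)⟩)
          exact hY a' ha' b hb h
        by_cases hx : ∃ a ∈ A, JoinedIn H Yᶜ a x
        · have hy : ¬ ∃ a ∈ A, JoinedIn H Yᶜ a y := fun hy => hclosed (iff_of_true hx hy)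
          exact Linkage.of_delete_edge hxy hHG hsep hY hYk hx hy ihH
        · have hy : ∃ a ∈ A, JoinedIn H Yᶜ a y := by
            by_contra hy
            exact hclosed (iff_of_false hx hy)
          refine Linkage.of_delete_edge hxy.symm (fun a b => ?_) hsep hY hYk hy hx ihH
          rw [hHG, Sym2.eq_swap (a := x)]
    · push Not at hG
      have hk := hsep (A ∩ B) fun a ha b hb hab => by
        have hba : b = a := hab.mem_of_closed (R := {a}) rfl
          fun p _ q _ hpq => absurd hpq (hG p q)
        exact hab.left_mem ⟨ha, hba ▸ hb⟩
      have := Fintype.ofFinite (A ∩ B : Set V)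
      obtain ⟨f⟩ : Nonempty (Fin k ↪ (A ∩ B : Set V)) := by
        apply Function.Embedding.nonempty_of_card_le
        rwa [Fintype.card_fin, ← Nat.card_eq_fintype_card, Nat.card_coe_set_eq]
      refine ⟨fun i => {(f i : V)}, fun i => f i, fun i => f i, fun i => (f i).2.1,
        fun i => (f i).2.2, fun i j hij => ?_, fun i => JoinedIn.refl rfl⟩
      simpa [Subtype.val_inj] using hij

/-! ### Lifting knittedness and composing separations -/

/-- If `(L[B], D)` is knitted, then the edges of a clique on `D` may be used to knit `(L[X ∪ B], T)`. -/
theorem KnittedOn.lift_clique {G L : SimpleGraph V} {X B D T : Set V} (hB : KnittedOn L B D)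
    (hX : KnittedOn G X T) (hXB : X ∩ B ⊆ D) (hTX : T ⊆ X)
    (hadj : ∀ x y, G.Adj x y → L.Adj x y ∨ x ∈ D ∧ y ∈ D) : KnittedOn L (X ∪ B) T := by
  intro ι s t hs ht hst
  obtain ⟨C, hCX, hCd, hCj, hCT⟩ := hX ι s t hs ht hst
  have hL0 : ∀ {i a b}, JoinedIn G (C i \ D) a b → JoinedIn L (C i \ D) a b := fun h =>
    h.map_adj subset_rfl fun x hx y _ e => (hadj x y e).resolve_right fun h => hx.2 h.1
  -- A walk with only one vertex in `D` uses no edge between two vertices of `D`.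
  have hL1 : ∀ {i c a b}, JoinedIn G (insert c (C i \ D)) a b →
      JoinedIn L (insert c (C i \ D)) a b := fun h =>
    h.map_adj subset_rfl fun x hx y hy e => (hadj x y e).resolve_right fun h =>
      e.ne ((hx.resolve_right fun h' => h'.2 h.1).trans (hy.resolve_right fun h' => h'.2 h.2).symm)
  -- Only these indices need a detour: their walk is cut at its first and last vertices in `D`,
  -- which are then joined inside `B`.
  let I := {i : ι // ¬ JoinedIn L (C i \ D) (s i) (t i)}
  have hI : ∀ i : I, ∃ a b, a ∈ C i ∩ D ∧ b ∈ C i ∩ D ∧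
      JoinedIn L (insert a (C i \ D)) (s i) a ∧ JoinedIn L (insert b (C i \ D)) (t i) b := by
    rintro ⟨i, hi⟩
    obtain ⟨a, ha, hja⟩ := ((hCj i).first_hit D).resolve_left fun h => hi (hL0 h)
    obtain ⟨b, hb, hjb⟩ := ((hCj i).symm.first_hit D).resolve_left fun h => hi (hL0 h).symm
    exact ⟨a, b, ha, hb, hL1 hja, hL1 hjb⟩
  choose a b ha hb hja hjb using hI
  obtain ⟨E, hEB, hEd, hEj, hED⟩ := hB I a b (fun i => (ha i).2) (fun i => (hb i).2) (by
    intro i j hij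
    have hCij : Disjoint (C i) (C j) := hCd fun h => hij (Subtype.ext h)
    refine hCij.mono ?_ ?_
    · exact Set.insert_subset (ha i).1 (Set.singleton_subset_iff.2 (hb i).1)
    · exact Set.insert_subset (ha j).1 (Set.singleton_subset_iff.2 (hb j).1))
  refine ⟨fun i => (C i \ D) ∪ ⋃ h, E ⟨i, h⟩, fun i => ?_, fun i j hij => ?_, fun i => ?_,
    fun i => ?_⟩
  · refine Set.union_subset_union (Set.sdiff_subset.trans (hCX i)) ?_
    exact Set.iUnion_subset fun h => hEB _
  · have hCE : ∀ i j h, Disjoint (C i \ D) (E ⟨j, h⟩) := fun i j h =>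
      Set.disjoint_left.2 fun z hz hz' => hz.2 (hXB ⟨hCX i hz.1, hEB _ hz'⟩)
    refine Set.disjoint_left.2 ?_
    rintro z (hz | hz) (hz' | hz')
    · exact Set.disjoint_left.1 (hCd hij) hz.1 hz'.1
    · obtain ⟨h, hz'⟩ := Set.mem_iUnion.1 hz'
      exact Set.disjoint_left.1 (hCE i j h) hz hz'
    · obtain ⟨h, hz⟩ := Set.mem_iUnion.1 hz
      exact Set.disjoint_left.1 (hCE j i h) hz' hz
    · obtain ⟨h, hz⟩ := Set.mem_iUnion.1 hz
      obtain ⟨h', hz'⟩ := Set.mem_iUnion.1 hz'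
      exact Set.disjoint_left.1 (hEd fun heq => hij (congrArg Subtype.val heq)) hz hz'
  · by_cases h : JoinedIn L (C i \ D) (s i) (t i)
    · exact h.mono Set.subset_union_left
    · have hE : E ⟨i, h⟩ ⊆ (C i \ D) ∪ ⋃ h, E ⟨i, h⟩ :=
        (Set.subset_iUnion (fun h => E ⟨i, h⟩) h).trans Set.subset_union_right
      have hj := hEj ⟨i, h⟩
      have h1 := (hja ⟨i, h⟩).mono (Set.insert_subset (hE hj.left_mem) Set.subset_union_left)
      have h2 := (hjb ⟨i, h⟩).mono (Set.insert_subset (hE hj.right_mem) Set.subset_union_left)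
      exact (h1.trans (hj.mono hE)).trans h2.symm
  · rintro z ⟨hz | hz, hzT⟩
    · exact hCT i ⟨hz.1, hzT⟩
    · obtain ⟨h, hz⟩ := Set.mem_iUnion.1 hz
      refine hCT i ⟨?_, hzT⟩
      rcases hED ⟨i, h⟩ ⟨hz, hXB ⟨hTX hzT, hEB _ hz⟩⟩ with rfl | rfl
      exacts [(ha ⟨i, h⟩).1, (hb ⟨i, h⟩).1]

/-- Knittedness lifts through the contraction of an edge `uv` to `u`. -/
theorem KnittedOn.lift_contraction {G L : SimpleGraph V} {X T : Set V} {u v : V}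
    (hX : KnittedOn G X T) (hTX : T ⊆ X) (hv : v ∉ X) (huv : L.Adj u v)
    (hadj : ∀ x y, G.Adj x y → L.Adj x y ∨ x = u ∧ L.Adj v y ∨ y = u ∧ L.Adj v x) :
    KnittedOn L (insert v X) T := by
  intro ι s t hs ht hst
  obtain ⟨C, hCX, hCd, hCj, hCT⟩ := hX ι s t hs ht hst
  refine ⟨fun i => C i ∪ {z | z = v ∧ u ∈ C i}, fun i => ?_, fun i j hij => ?_, fun i => ?_,
    fun i => ?_⟩
  · rintro z (hz | ⟨rfl, -⟩)
    exacts [.inr (hCX i hz), .inl rfl]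
  · refine Set.disjoint_left.2 ?_
    rintro z (hz | ⟨rfl, hz⟩) (hz' | ⟨h, hz'⟩)
    · exact Set.disjoint_left.1 (hCd hij) hz hz'
    · exact hv (hCX i (h ▸ hz))
    · exact hv (hCX j hz')
    · exact Set.disjoint_left.1 (hCd hij) hz hz'
  · refine (hCj i).induct (motive := fun x => JoinedIn L (C i ∪ {z | z = v ∧ u ∈ C i}) x (t i))
      (fun h => JoinedIn.refl (.inl h)) fun x y hx hxy hy ih => ?_
    rcases hadj x y hxy with h | ⟨rfl, h⟩ | ⟨rfl, h⟩
    · exact ih.cons h (.inl hx)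
    · exact (ih.cons h (.inr ⟨rfl, hx⟩)).cons huv (.inl hx)
    · exact (ih.cons huv.symm (.inr ⟨rfl, hy.left_mem⟩)).cons h.symm (.inl hx)
  · rintro z ⟨hz | ⟨rfl, -⟩, hzT⟩
    · exact hCT i ⟨hz, hzT⟩
    · exact absurd (hTX hzT) hv

/-- A separation of the right side with terminal set `C ∩ D` extends to the whole pair with the same
order and the same new part, so violations inside `D` are violations outside. -/
theorem SepOn.trans {G : SimpleGraph V} {X T C D C' D' : Set V} (h : SepOn G X T C D)
    (h' : SepOn G D (C ∩ D) C' D') : SepOn G X T (C ∪ C') D' ∧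
      (C ∪ C') ∩ D' = C' ∩ D' ∧ D' \ (C ∪ C') = D' \ C' := by
  have hD' : D' ⊆ D := h'.union_eq ▸ Set.subset_union_right
  have hC : ∀ z ∈ C, z ∈ D → z ∈ C' := fun z hz hz' => h'.subset_left ⟨hz, hz'⟩
  refine ⟨⟨?_, ?_, h.subset_left.trans Set.subset_union_left⟩, ?_, ?_⟩
  · rw [Set.union_assoc, h'.union_eq, h.union_eq]
  · rintro a ⟨ha, haD⟩ b ⟨hb, hbC⟩ hab
    have hbC' : b ∉ C' := fun h => hbC (.inr h)
    by_cases ha' : a ∈ C'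
    · exact h'.not_adj a ⟨ha', haD⟩ b ⟨hb, hbC'⟩ hab
    · have haC := ha.resolve_right ha'
      exact h.not_adj a ⟨haC, fun h => ha' (hC a haC h)⟩ b ⟨hD' hb, fun h => hbC (.inl h)⟩ hab
  · ext z
    constructor
    · rintro ⟨hz | hz, hzD⟩
      exacts [⟨hC z hz (hD' hzD), hzD⟩, ⟨hz, hzD⟩]
    · rintro ⟨hz, hzD⟩
      exact ⟨.inr hz, hzD⟩
  · ext z
    constructor
    · rintro ⟨hzD, hz⟩
      exact ⟨hzD, fun h => hz (.inr h)⟩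
    · rintro ⟨hzD, hz⟩
      exact ⟨hzD, fun h => hz (h.elim (fun h => hC z h (hD' hzD)) id)⟩

/-- A separation violating massedness can be chosen such that its right side is massed. -/
theorem exists_massedOn_of_violation [Finite V] {p : ℕ} {G : SimpleGraph V} {X T C D : Set V}
    (h : SepOn G X T C D) (hlt : (C ∩ D).ncard < T.ncard)
    (hrho : p * (D \ C).ncard < 2 * rho G (D \ C)) :
    ∃ C D, SepOn G X T C D ∧ (C ∩ D).ncard < T.ncard ∧ MassedOn p G D (C ∩ D) := by
  induction hn : D.ncard using Nat.strong_induction_on generalizing C D with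
  | _ n ih =>
    by_cases hm : ∀ C' D', SepOn G D (C ∩ D) C' D' → (C' ∩ D').ncard < (C ∩ D).ncard →
        2 * rho G (D' \ C') ≤ p * (D' \ C').ncard
    · refine ⟨C, D, h, hlt, ?_, hm⟩
      rwa [Set.sdiff_inter, Set.sdiff_self, Set.union_empty]
    · push Not at hm
      obtain ⟨C', D', h', hlt', hrho'⟩ := hm
      obtain ⟨h1, h2, h3⟩ := h.trans h'
      refine ih _ ?_ h1 (by rw [h2]; omega) (by rwa [h3]) rfl
      rw [← hn]
      have hD' : D' ⊆ D := h'.union_eq ▸ Set.subset_union_right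
      refine Set.ncard_lt_ncard (hD'.ssubset_of_ne ?_) (Set.toFinite _)
      rintro rfl
      refine absurd hlt' (not_lt.2 (Set.ncard_le_ncard ?_ (Set.toFinite _)))
      exact Set.subset_inter h'.subset_left Set.inter_subset_right

/-- A separation of the minimum possible order whose right side is knitted shows that the whole pair
is knitted. -/
theorem KnittedOn.of_sepOn [Finite V] {L : SimpleGraph V} {X T A B : Set V}
    (hAB : SepOn L X T A B) (hB : KnittedOn L B (A ∩ B))
    (hmin : ∀ C D, SepOn L X T C D → C ⊆ A → B ⊆ D → T.ncard ≤ (C ∩ D).ncard) :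
    KnittedOn L X T := by
  let H : SimpleGraph V :=
    { Adj := fun x y => L.Adj x y ∧ x ∈ A ∧ y ∈ A
      symm := ⟨fun x y h => ⟨h.1.symm, h.2.2, h.2.1⟩⟩
      loopless := ⟨fun x h => h.1.ne rfl⟩ }
  have hHA : ∀ {C : Set V} {a b}, JoinedIn H C a b → a ∈ A → b ∈ A := fun h ha =>
    h.mem_of_closed ha fun _ _ _ _ e => e.2.2
  have hlink : Linkage H T (A ∩ B) T.ncard := by
    refine linkage_of_separates H T (A ∩ B) fun Z hZ => ?_
    set R : Set V := {z | ∃ a ∈ T, JoinedIn H Zᶜ a z} with hRdef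
    have hRA : R ⊆ A := fun z ⟨a, ha, h⟩ => hHA h (hAB.subset_left ha)
    have hRZ : ∀ z ∈ R, z ∉ Z := fun z ⟨a, ha, h⟩ => h.right_mem
    have hRB : ∀ z ∈ R, z ∉ B := fun z hz hzB => by
      obtain ⟨a, ha, h⟩ := id hz
      exact hZ a ha z ⟨hRA hz, hzB⟩ h
    have hX : A ∪ B = X := hAB.union_eq
    -- A set `Z` separating `T` from `A ∩ B` in `L[A]` gives a separation whose two sides meet only
    -- in vertices of `Z`.
    have := hmin (R ∪ (Z ∩ A)) (X \ R) ⟨?_, ?_, ?_⟩ (Set.union_subset hRA Set.inter_subset_right)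
      fun z hz => ⟨hX ▸ .inr hz, fun h => hRB z h hz⟩
    · refine this.trans (Set.ncard_le_ncard ?_ (Set.toFinite _))
      rintro z ⟨hz | hz, hz'⟩
      exacts [absurd hz hz'.2, hz.1]
    · ext z
      constructor
      · rintro ((hz | hz) | hz)
        exacts [hX ▸ .inl (hRA hz), hX ▸ .inl hz.2, hz.1]
      · intro hz
        by_cases hzR : z ∈ R
        exacts [.inl (.inl hzR), .inr ⟨hz, hzR⟩]
    · rintro a ⟨ha, ha'⟩ b ⟨hb, hb'⟩ hab
      have haR : a ∈ R := by
        rcases ha with ha | ha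
        · exact ha
        · by_contra haR
          exact ha' ⟨hX ▸ .inl ha.2, haR⟩
      have haA := hRA haR
      by_cases hbA : b ∈ A
      · have hbZ : b ∉ Z := fun h => hb' (.inr ⟨h, hbA⟩)
        obtain ⟨c, hc, h⟩ := id haR
        exact hb.2 ⟨c, hc, h.trans (.of_adj ⟨hab, haA, hbA⟩ (hRZ a haR) hbZ)⟩
      · exact hAB.not_adj a ⟨haA, hRB a haR⟩ b ⟨(hX ▸ hb.1 : b ∈ A ∪ B).resolve_left hbA, hbA⟩ hab
    · intro z hz
      by_cases hzZ : z ∈ Z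
      exacts [.inr ⟨hzZ, hAB.subset_left hz⟩, .inl ⟨z, hz, JoinedIn.refl hzZ⟩]
  obtain ⟨C, s, t, hs, ht, hd, hj, hCD, hC⟩ := hlink.trim
  have hCA : ∀ i, C i ⊆ A := by
    intro i z hz
    by_cases hzt : z = t i
    · exact hzt ▸ (ht i).1
    · exact hHA (hC i z hz hzt) (hAB.subset_left (hs i))
  have hsinj : Function.Injective s := injective_of_pairwise_disjoint hd fun i => (hj i).left_mem
  have htinj : Function.Injective t := injective_of_pairwise_disjoint hd fun i => (hj i).right_mem
  have hsurj : ∀ z ∈ T, ∃ i, s i = z := fun z hz => exists_eq_of_injective rfl hs hsinj hz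
  intro ι σ τ hσ hτ hστ
  choose p hp using fun i => hsurj _ (hσ i)
  choose q hq using fun i => hsurj _ (hτ i)
  have hne : ∀ i j, i ≠ j → (p i ≠ p j ∧ p i ≠ q j) ∧ (q i ≠ p j ∧ q i ≠ q j) := by
    intro i j hij
    have := hστ hij
    simp only [← hp, ← hq, Set.disjoint_insert_left, Set.disjoint_insert_right,
      Set.disjoint_singleton_left, Set.mem_insert_iff,
      Set.mem_singleton_iff, hsinj.eq_iff] at this
    tauto
  obtain ⟨E, hEB, hEd, hEj, hED⟩ := hB ι (fun i => t (p i)) (fun i => t (q i)) (fun i => ht _)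
    (fun i => ht _) (by
      intro i j hij
      have := hne i j hij
      simp only [Set.disjoint_insert_left, Set.disjoint_insert_right,
        Set.disjoint_singleton_left, Set.mem_insert_iff,
        Set.mem_singleton_iff, htinj.eq_iff]
      tauto)
  have hCE : ∀ k j, k ≠ p j → k ≠ q j → Disjoint (C k) (E j) := by
    intro k j hkp hkq
    rw [Set.disjoint_left]
    intro z hz hz'
    have hzAB : z ∈ A ∩ B := ⟨hCA k hz, hEB j hz'⟩
    have hzt : z = t k := hCD k ⟨hz, hzAB⟩
    rcases hED j ⟨hz', hzAB⟩ with h | h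
    · exact hkp (htinj (hzt.symm.trans h))
    · exact hkq (htinj (hzt.symm.trans h))
  have hCT : ∀ k, ∀ z ∈ C k, z ∈ T → z = s k := by
    intro k z hz hzT
    obtain ⟨k', rfl⟩ := hsurj z hzT
    by_contra hkk
    exact Set.disjoint_left.1 (hd fun h => hkk (by rw [h])) hz (hj k').left_mem
  refine ⟨fun i => (C (p i) ∪ C (q i)) ∪ E i, fun i => ?_, fun i j hij => ?_, fun i => ?_,
    fun i => ?_⟩
  · rw [← hAB.union_eq]
    exact Set.union_subset_union (Set.union_subset (hCA _) (hCA _)) (hEB i)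
  · obtain ⟨⟨h1, h2⟩, h3, h4⟩ := hne i j hij
    refine Set.disjoint_left.2 ?_
    rintro z ((hz | hz) | hz) ((hz' | hz') | hz')
    · exact Set.disjoint_left.1 (hd h1) hz hz'
    · exact Set.disjoint_left.1 (hd h2) hz hz'
    · exact Set.disjoint_left.1 (hCE _ _ h1 h2) hz hz'
    · exact Set.disjoint_left.1 (hd h3) hz hz'
    · exact Set.disjoint_left.1 (hd h4) hz hz'
    · exact Set.disjoint_left.1 (hCE _ _ h3 h4) hz hz'
    · exact Set.disjoint_left.1 (hCE _ _ h1.symm h3.symm) hz' hz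
    · exact Set.disjoint_left.1 (hCE _ _ h2.symm h4.symm) hz' hz
    · exact Set.disjoint_left.1 (hEd hij) hz hz'
  · have h1 : ∀ k, C k ⊆ (C (p i) ∪ C (q i)) ∪ E i → JoinedIn L ((C (p i) ∪ C (q i)) ∪ E i)
        (s k) (t k) := fun k hk => (hj k).map_adj hk fun _ _ _ _ e => e.1
    have hP := h1 (p i) (Set.subset_union_left.trans Set.subset_union_left)
    have hQ := h1 (q i) (Set.subset_union_right.trans Set.subset_union_left)
    rw [hp] at hP
    rw [hq] at hQ
    exact (hP.trans ((hEj i).mono Set.subset_union_right)).trans hQ.symm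
  · have key : ∀ z ∈ C (p i) ∪ C (q i), z ∈ T → z ∈ ({σ i, τ i} : Set V) := by
      rintro z (hz | hz) hzT
      · exact .inl ((hCT _ z hz hzT).trans (hp i))
      · exact .inr ((hCT _ z hz hzT).trans (hq i))
    rintro z ⟨hz | hz, hzT⟩
    · exact key z hz hzT
    · refine key z ?_ hzT
      rcases hED i ⟨hz, hAB.subset_left hzT, hEB i hz⟩ with rfl | rfl
      · exact .inl (hj _).right_mem
      · exact .inr (hj _).right_mem

/-! ### A minimal pair has no rigid separation -/

theorem isRigidSeparation_iff {L : SimpleGraph V} {S A B : Set V} :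
    IsRigidSeparation L S A B ↔
      SepOn L Set.univ S A B ∧ (B \ A).Nonempty ∧ KnittedOn L B (A ∩ B) := by
  rw [← isSeparation_iff_sepOn_univ, ← knitted_induce_iff Set.inter_subset_right]
  exact ⟨fun h => ⟨h.1, h.2, h.3⟩, fun h => ⟨h.1, h.2.1, h.2.2⟩⟩

theorem SepOn.closed {G : SimpleGraph V} {X T C D : Set V} (h : SepOn G X T C D)
    (hX : ∀ x ∈ D \ C, ∀ y, G.Adj x y → y ∈ X) :
    ∀ x ∈ D \ (C ∩ D), ∀ y, G.Adj x y → y ∈ D := by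
  rintro x ⟨hxD, hxC⟩ y hxy
  have hx : x ∈ D \ C := ⟨hxD, fun h => hxC ⟨h, hxD⟩⟩
  have hy : y ∈ C ∪ D := h.union_eq ▸ hX x hx y hxy
  by_contra hyD
  exact h.not_adj y ⟨hy.resolve_right hyD, hyD⟩ x hx hxy.symm

theorem mem_rho_set {L : SimpleGraph V} {T : Set V} {x y : V} :
    s(x, y) ∈ {e ∈ L.edgeSet | ∃ v ∈ T, v ∈ e} ↔ L.Adj x y ∧ (x ∈ T ∨ y ∈ T) := by
  simp only [Set.mem_ofPred_eq, SimpleGraph.mem_edgeSet, Sym2.mem_iff]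
  refine and_congr_right fun _ => ⟨?_, ?_⟩
  · rintro ⟨v, hv, rfl | rfl⟩
    exacts [.inl hv, .inr hv]
  · rintro (h | h)
    exacts [⟨x, h, .inl rfl⟩, ⟨y, h, .inr rfl⟩]

theorem rho_le_rho [Finite V] {G L : SimpleGraph V} {T : Set V}
    (h : ∀ x ∈ T, ∀ y, G.Adj x y → L.Adj x y) : rho G T ≤ rho L T := by
  refine Set.ncard_le_ncard (fun e => ?_) (Set.toFinite _)
  induction e with
  | h a b =>
    simp only [mem_rho_set]
    rintro ⟨hab, ha | hb⟩
    exacts [⟨h a ha b hab, .inl ha⟩, ⟨(h b hb a hab.symm).symm, .inr hb⟩]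

theorem rho_empty (L : SimpleGraph V) : rho L ∅ = 0 := by
  simp [rho]

section Minimal

variable {l p : ℕ} {L : SimpleGraph V} {S : Set V}

theorem IsMinimalPair.massedOn (hmin : IsMinimalPair l p L S) : MassedOn p L Set.univ S :=
  massed_iff_massedOn_univ.1 hmin.admissible.massed

theorem IsMinimalPair.not_knittedOn (hmin : IsMinimalPair l p L S) :
    ¬ KnittedOn L Set.univ S := fun h =>
  hmin.admissible.not_knitted (knitted_iff_knittedOn_univ.2 h)

theorem IsMinimalPair.ncard_lt (hmin : IsMinimalPair l p L S) : S.ncard + 1 ≤ p / 2 := by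
  have := hmin.le_half
  have := hmin.admissible.ncard_le
  omega

variable [Finite V]

/-- Among the separations `(C, D)` with `C ⊆ A` and `B ⊆ D`, one of least order is linked to `A ∩ B`
by Menger's theorem, so `D` inherits knittedness from `B`. If that order were at least `|S|`, the
same argument would apply to `S` itself. -/
theorem IsMinimalPair.exists_rigid_of_rigid (hmin : IsMinimalPair l p L S) {A B : Set V}
    (hAB : SepOn L Set.univ S A B) (hne : (B \ A).Nonempty) (hB : KnittedOn L B (A ∩ B)) :
    ∃ C D, SepOn L Set.univ S C D ∧ (D \ C).Nonempty ∧ KnittedOn L D (C ∩ D) ∧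
      (C ∩ D).ncard < S.ncard := by
  by_cases hm : ∀ C D, SepOn L Set.univ S C D → C ⊆ A → B ⊆ D → S.ncard ≤ (C ∩ D).ncard
  · exact absurd (KnittedOn.of_sepOn hAB hB hm) hmin.not_knittedOn
  · push Not at hm
    obtain ⟨C₀, D₀, hCD₀, hCA₀, hBD₀, hlt₀⟩ := hm
    obtain ⟨⟨C, D⟩, ⟨hCD, hCA, hBD⟩, hleast⟩ := Set.exists_min_image
      {q : Set V × Set V | SepOn L Set.univ S q.1 q.2 ∧ q.1 ⊆ A ∧ B ⊆ q.2}
      (fun q => (q.1 ∩ q.2).ncard) (Set.toFinite _) ⟨(C₀, D₀), hCD₀, hCA₀, hBD₀⟩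
    simp only at hCD hCA hBD hleast
    refine ⟨C, D, hCD, ?_, ?_, (hleast (C₀, D₀) ⟨hCD₀, hCA₀, hBD₀⟩).trans_lt hlt₀⟩
    · obtain ⟨z, hzB, hzA⟩ := hne
      exact ⟨z, hBD hzB, fun h => hzA (hCA h)⟩
    · have hABD : (A ∩ D) ∩ B = A ∩ B := by
        ext z
        exact ⟨fun h => ⟨h.1.1, h.2⟩, fun h => ⟨⟨h.1, hBD h.2⟩, h.2⟩⟩
      refine KnittedOn.of_sepOn (A := A ∩ D) (B := B) ⟨?_, ?_, ?_⟩ (hABD ▸ hB) ?_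
      · ext z
        refine ⟨fun h => h.elim (fun h => h.2) fun h => hBD h, fun h => ?_⟩
        rcases (hAB.union_eq ▸ Set.mem_univ z : z ∈ A ∪ B) with h' | h'
        exacts [.inl ⟨h', h⟩, .inr h']
      · rintro a ⟨ha, haB⟩ b ⟨hb, hbA⟩
        exact hAB.not_adj a ⟨ha.1, haB⟩ b ⟨hb, fun h => hbA ⟨h, hBD hb⟩⟩
      · exact Set.inter_subset_inter_left _ hCA
      · intro C' D' hCD' hCA' hBD'
        obtain ⟨h1, h2, -⟩ := hCD.trans hCD'
        rw [← h2]
        exact hleast (C ∪ C', D') ⟨h1, Set.union_subset hCA (hCA'.trans Set.inter_subset_left), hBD'⟩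

/-- The graph obtained from `L[A]` by making `A ∩ B` a clique. -/
def cliqueOn (L : SimpleGraph V) (A B : Set V) : SimpleGraph V where
  Adj x y := x ≠ y ∧ x ∈ A ∧ y ∈ A ∧ (L.Adj x y ∨ x ∈ B ∧ y ∈ B)
  symm := ⟨fun _ _ h => ⟨h.1.symm, h.2.2.1, h.2.1, h.2.2.2.imp (·.symm) And.symm⟩⟩
  loopless := ⟨fun _ h => h.1 rfl⟩

theorem IsMinimalPair.not_rigid_of_lt (hmin : IsMinimalPair l p L S) {A B : Set V}
    (hAB : SepOn L Set.univ S A B) (hne : (B \ A).Nonempty) (hB : KnittedOn L B (A ∩ B))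
    (hlt : (A ∩ B).ncard < S.ncard) : False := by
  induction hn : A.ncard using Nat.strong_induction_on generalizing A B with
  | _ n ih =>
    set G := cliqueOn L A B with hG
    have hadj : ∀ x y, G.Adj x y → L.Adj x y ∨ x ∈ A ∩ B ∧ y ∈ A ∩ B := fun x y h =>
      h.2.2.2.imp_right fun h' => ⟨⟨h.2.1, h'.1⟩, h.2.2.1, h'.2⟩
    have hAu : ∀ z, z ∈ A ∨ z ∈ B := fun z => (hAB.union_eq ▸ Set.mem_univ z : z ∈ A ∪ B)
    have hAne : A ≠ Set.univ := by
      rintro rfl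
      exact hne.some_mem.2 trivial
    refine hmin.not_knittedOn ?_
    rw [← hAB.union_eq]
    refine hB.lift_clique (hmin.knittedOn (G := G) hAne hAB.subset_left
      (fun x _ y h => h.2.2.1) hmin.admissible.ncard_le ⟨?_, ?_⟩) subset_rfl hAB.subset_left hadj
    · have h1 := hmin.massedOn.lt_rho
      have h2 := hmin.massedOn.rho_le A B hAB hlt
      have h3 : (Set.univ \ S).ncard = (A \ S).ncard + (B \ A).ncard := by
        rw [← Set.ncard_union_eq (Set.disjoint_left.2 fun z hz hz' => hz'.2 hz.1)]
        congr 1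
        ext z
        have := hAu z
        have := @hAB.subset_left z
        simp only [Set.mem_sdiff, Set.mem_union, Set.mem_univ, true_and]
        tauto
      have h4 : rho L (Set.univ \ S) ≤ rho G (A \ S) + rho L (B \ A) := by
        refine (Set.ncard_le_ncard (fun e => ?_) (Set.toFinite _)).trans (Set.ncard_union_le _ _)
        induction e with
        | h a b =>
          rw [Set.mem_union, mem_rho_set, mem_rho_set, mem_rho_set]
          rintro ⟨hab, hS⟩
          by_cases ha : a ∈ A
          · by_cases hb : b ∈ A
            · exact .inl ⟨⟨hab.ne, ha, hb, .inl hab⟩, hS.imp (⟨ha, ·.2⟩) (⟨hb, ·.2⟩)⟩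
            · exact .inr ⟨hab, .inr ⟨(hAu b).resolve_left hb, hb⟩⟩
          · exact .inr ⟨hab, .inl ⟨(hAu a).resolve_left ha, ha⟩⟩
      rw [h3] at h1
      have := mul_add p (A \ S).ncard (B \ A).ncard
      omega
    · by_contra! hcon
      obtain ⟨C₀, D₀, hCD₀, hlt₀, hrho₀⟩ := hcon
      obtain ⟨C, D, hCD, hltC, hm⟩ := exists_massedOn_of_violation hCD₀ hlt₀ hrho₀
      have hCA : C ⊆ A := hCD.union_eq ▸ Set.subset_union_left
      have hDA : D ⊆ A := hCD.union_eq ▸ Set.subset_union_right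
      have hACD : ∀ z ∈ A, z ∈ C ∨ z ∈ D := fun z hz => (hCD.union_eq ▸ hz : z ∈ C ∪ D)
      -- The clique on `A ∩ B` lies in `C` or in `D`, and `B` is added to that side. In the first
      -- case `L` is not massed; in the second `(C, D ∪ B)` is rigid with a smaller left side.
      by_cases hC : A ∩ B ⊆ C
      · have hsep : SepOn L Set.univ S (C ∪ B) D := by
          refine ⟨?_, ?_, hCD.subset_left.trans Set.subset_union_left⟩
          · rw [Set.union_right_comm, hCD.union_eq, hAB.union_eq]
          · rintro a ⟨ha, haD⟩ b ⟨hb, hbCB⟩ hab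
            have hbC : b ∉ C := fun h => hbCB (.inl h)
            have hbB : b ∉ B := fun h => hbCB (.inr h)
            by_cases haA : a ∈ A
            · exact hCD.not_adj a ⟨(hACD a haA).resolve_right haD, haD⟩ b ⟨hb, hbC⟩
                ⟨hab.ne, haA, hDA hb, .inl hab⟩
            · exact hAB.not_adj b ⟨hDA hb, hbB⟩ a ⟨(hAu a).resolve_left haA, haA⟩ hab.symm
        have hint : (C ∪ B) ∩ D = C ∩ D := by
          ext z
          exact ⟨fun h => ⟨h.1.elim id fun h' => hC ⟨hDA h.2, h'⟩, h.2⟩, fun h => ⟨.inl h.1, h.2⟩⟩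
        have hdiff : D \ (C ∪ B) = D \ (C ∩ D) := by
          rw [← Set.sdiff_inter_self_eq_sdiff, hint]
        have h1 := hmin.massedOn.rho_le _ _ hsep (hint ▸ hltC)
        have h2 := hm.lt_rho
        rw [hdiff] at h1
        have h3 : rho G (D \ (C ∩ D)) ≤ rho L (D \ (C ∩ D)) := by
          rw [← hdiff]
          refine rho_le_rho fun x hx y hxy => (hadj x y hxy).resolve_right fun h => hx.2 (.inr h.1.2)
        omega
      · obtain ⟨z, hz, hzC⟩ := Set.not_subset.1 hC
        have hzD : z ∈ D := (hACD z hz.1).resolve_left hzC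
        have hABD : A ∩ B ⊆ D := by
          intro w hw
          by_contra hwD
          exact hCD.not_adj w ⟨(hACD w hw.1).resolve_right hwD, hwD⟩ z ⟨hzD, hzC⟩
            ⟨fun h => hwD (h ▸ hzD), hw.1, hz.1, .inr ⟨hw.2, hz.2⟩⟩
        have hint : C ∩ (D ∪ B) = C ∩ D := by
          ext w
          exact ⟨fun h => ⟨h.1, h.2.elim id fun h' => hABD ⟨hCA h.1, h'⟩⟩, fun h => ⟨h.1, .inl h.2⟩⟩
        refine ih C.ncard ?_ (A := C) (B := D ∪ B) ⟨?_, ?_, hCD.subset_left⟩ ⟨z, .inl hzD, hzC⟩ ?_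
          (hint ▸ hltC) rfl
        · rw [← hn]
          exact Set.ncard_lt_ncard ⟨hCA, fun h => hzC (h hz.1)⟩ (Set.toFinite _)
        · rw [← Set.union_assoc, hCD.union_eq, hAB.union_eq]
        · rintro a ⟨ha, haDB⟩ b ⟨hb, hbC⟩ hab
          have haD : a ∉ D := fun h => haDB (.inl h)
          by_cases hbA : b ∈ A
          · exact hCD.not_adj a ⟨ha, haD⟩ b ⟨hb.elim id fun h => hABD ⟨hbA, h⟩, hbC⟩
              ⟨hab.ne, hCA ha, hbA, .inl hab⟩
          · exact hAB.not_adj a ⟨hCA ha, fun h => haDB (.inr h)⟩ b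
              ⟨(hAu b).resolve_left hbA, hbA⟩ hab
        · rw [hint]
          refine hB.lift_clique (hmin.knittedOn (G := G) (fun h => hAne ?_) Set.inter_subset_right
            (hCD.closed fun x _ y h => h.2.2.1) ?_ hm) (Set.inter_subset_inter_left _ hDA)
            Set.inter_subset_right hadj
          · exact Set.eq_univ_of_univ_subset (h ▸ hDA)
          · have := hmin.admissible.ncard_le
            omega

/-- A minimal pair has no rigid separation. -/
theorem IsMinimalPair.not_rigid (hmin : IsMinimalPair l p L S) {A B : Set V}
    (hAB : SepOn L Set.univ S A B) (hne : (B \ A).Nonempty) (hB : KnittedOn L B (A ∩ B)) :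
    False := by
  obtain ⟨C, D, h1, h2, h3, h4⟩ := hmin.exists_rigid_of_rigid hAB hne hB
  exact hmin.not_rigid_of_lt h1 h2 h3 h4

/-- Massedness bounds only orders below `|S|`; the gain here is order `|S|`. A violation would make
`(L[B], A ∩ B)` massed because separations compose, hence knitted by minimality, hence `(A, B)`
rigid. -/
theorem IsMinimalPair.rho_le (hmin : IsMinimalPair l p L S) {A B : Set V}
    (hAB : SepOn L Set.univ S A B) (hle : (A ∩ B).ncard ≤ S.ncard) (hB : B ≠ Set.univ) :
    2 * rho L (B \ A) ≤ p * (B \ A).ncard := by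
  by_contra! hcon
  have hm : MassedOn p L B (A ∩ B) := by
    refine ⟨by rwa [Set.inter_comm, Set.sdiff_self_inter], fun C D hCD hlt => ?_⟩
    obtain ⟨h1, h2, h3⟩ := hAB.trans hCD
    rw [← h3]
    exact hmin.massedOn.rho_le _ _ h1 (by rw [h2]; omega)
  refine hmin.not_rigid hAB ?_ (hmin.knittedOn hB Set.inter_subset_right
    (hAB.closed fun _ _ _ _ => trivial) (hle.trans hmin.admissible.ncard_le) hm)
  rw [Set.nonempty_iff_ne_empty]
  intro h
  rw [h, rho_empty] at hcon
  omega

end Minimal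

/-! ### Contracting an edge of a minimal pair -/

/-- The graph obtained from `L` by contracting `v` into `u`, with `v` kept as an isolated vertex. -/
def contraction (L : SimpleGraph V) (u v : V) : SimpleGraph V where
  Adj x y := x ≠ y ∧ x ≠ v ∧ y ≠ v ∧ (L.Adj x y ∨ x = u ∧ L.Adj v y ∨ y = u ∧ L.Adj v x)
  symm := ⟨fun _ _ h => ⟨h.1.symm, h.2.2.1, h.2.1,
    h.2.2.2.elim (fun h => .inl h.symm) fun h => .inr h.symm⟩⟩
  loopless := ⟨fun _ h => h.1 rfl⟩

section
variable [Finite V] {l p : ℕ} {L : SimpleGraph V} {S : Set V} {u v : V}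

theorem rho_contraction_le {T : Set V} (hu : u ∉ T) :
    rho (contraction L u v) T ≤ rho L T := by
  classical
  have key : {e ∈ (contraction L u v).edgeSet | ∃ v ∈ T, v ∈ e} ⊆
      (Sym2.map fun x => if x = v then u else x) '' {e ∈ L.edgeSet | ∃ v ∈ T, v ∈ e} := by
    have aux : ∀ x ∈ T, ∀ y, (contraction L u v).Adj x y → s(x, y) ∈
        (Sym2.map fun x => if x = v then u else x) '' {e ∈ L.edgeSet | ∃ v ∈ T, v ∈ e} := by
      rintro x hx y ⟨-, hxv, hyv, h | ⟨rfl, -⟩ | ⟨rfl, h⟩⟩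
      · exact ⟨s(x, y), mem_rho_set.2 ⟨h, .inl hx⟩, by simp [hxv, hyv]⟩
      · exact absurd hx hu
      · exact ⟨s(x, v), mem_rho_set.2 ⟨h.symm, .inl hx⟩, by simp [hxv]⟩
    intro e
    induction e with
    | h a b =>
      rw [mem_rho_set]
      rintro ⟨hab, ha | hb⟩
      · exact aux a ha b hab
      · rw [Sym2.eq_swap]
        exact aux b hb a hab.symm
  exact (Set.ncard_le_ncard key (Set.toFinite _)).trans (Set.ncard_image_le (Set.toFinite _))

/-- The vertices `w` for which the edge `vw` disappears from the counted edges when `v` is contracted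
into `u`. -/
def lostVertices (L : SimpleGraph V) (S : Set V) (u v : V) : Set V :=
  {w | w ≠ u ∧ L.Adj v w ∧ (L.Adj u w ∨ u ∈ S ∧ w ∈ S)}

theorem rho_le_rho_contraction :
    rho L (Set.univ \ S) ≤
      rho (contraction L u v) ({v}ᶜ \ S) + ((lostVertices L S u v).ncard + 1) := by
  classical
  set K := lostVertices L S u v with hK
  let g : Sym2 V → Sym2 V := fun e =>
    if e ∈ L.edgeSet then e else Sym2.map (fun x => if x = u then v else x) e
  have key : {e ∈ L.edgeSet | ∃ v ∈ Set.univ \ S, v ∈ e} ⊆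
      g '' {e ∈ (contraction L u v).edgeSet | ∃ z ∈ {v}ᶜ \ S, z ∈ e} ∪
        (fun w => s(v, w)) '' insert u K := by
    have aux : ∀ w, L.Adj v w → s(v, w) ∈
        g '' {e ∈ (contraction L u v).edgeSet | ∃ z ∈ {v}ᶜ \ S, z ∈ e} ∪
        (fun w => s(v, w)) '' insert u K := by
      intro w hvw
      by_cases hwu : w = u
      · exact .inr ⟨w, .inl hwu, rfl⟩
      by_cases hwK : w ∈ K
      · exact .inr ⟨w, .inr hwK, rfl⟩
      have hw : ¬ (L.Adj u w ∨ u ∈ S ∧ w ∈ S) := fun h => hwK ⟨hwu, hvw, h⟩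
      push Not at hw
      by_cases huv : u = v
      · exact absurd (huv ▸ hvw) hw.1
      refine .inl ⟨s(u, w), mem_rho_set.2 ⟨⟨Ne.symm hwu, huv, hvw.ne', .inr (.inl ⟨rfl, hvw⟩)⟩, ?_⟩, ?_⟩
      · by_cases hu : u ∈ S
        · exact .inr ⟨hvw.ne', hw.2 hu⟩
        · exact .inl ⟨huv, hu⟩
      · simp [g, hw.1, hwu]
    intro e
    induction e with
    | h a b =>
      rw [mem_rho_set]
      rintro ⟨hab, hS⟩
      by_cases ha : a = v
      · exact ha ▸ aux b (ha ▸ hab)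
      by_cases hb : b = v
      · rw [Sym2.eq_swap]
        exact hb ▸ aux a (hb ▸ hab.symm)
      refine .inl ⟨s(a, b), mem_rho_set.2 ⟨⟨hab.ne, ha, hb, .inl hab⟩,
        hS.imp (fun h => ⟨ha, h.2⟩) fun h => ⟨hb, h.2⟩⟩, ?_⟩
      simp [g, hab]
  refine (Set.ncard_le_ncard key (Set.toFinite _)).trans ((Set.ncard_union_le _ _).trans ?_)
  refine add_le_add (Set.ncard_image_le (Set.toFinite _)) ?_
  exact (Set.ncard_image_le (Set.toFinite _)).trans (Set.ncard_insert_le _ _)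

/-- If the contraction kept enough edges, it would be massed, so knitted and liftable, or have a
violating separation. The latter is ruled out according to the side on which `u` lies. -/
theorem IsMinimalPair.le_ncard_lostVertices (hmin : IsMinimalPair l p L S) (huv : L.Adj u v)
    (hv : v ∉ S) : p / 2 ≤ (lostVertices L S u v).ncard := by
  set G := contraction L u v with hG
  have hX : ({v}ᶜ : Set V) ≠ Set.univ := fun h => (h ▸ Set.mem_univ v : v ∈ ({v}ᶜ : Set V)) rfl
  have hSX : S ⊆ {v}ᶜ := fun z hz h => hv (h ▸ hz)
  have hrho : 2 * rho G ({v}ᶜ \ S) ≤ p * ({v}ᶜ \ S).ncard := by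
    by_contra! hcon
    refine hmin.not_knittedOn ?_
    have := (hmin.knittedOn (G := G) hX hSX (fun x _ y h => h.2.2.1) hmin.admissible.ncard_le
      ⟨hcon, ?_⟩).lift_contraction hSX (by simp) huv fun x y h => h.2.2.2
    · rwa [Set.insert_eq, Set.union_compl_self] at this
    by_contra! hcon'
    obtain ⟨C₀, D₀, hCD₀, hlt₀, hrho₀⟩ := hcon'
    obtain ⟨C, D, hCD, hlt, hm⟩ := exists_massedOn_of_violation hCD₀ hlt₀ hrho₀
    have hCv : v ∉ C := fun h => (hCD.union_eq ▸ .inl h : v ∈ ({v}ᶜ : Set V)) rfl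
    have hDv : v ∉ D := fun h => (hCD.union_eq ▸ .inr h : v ∈ ({v}ᶜ : Set V)) rfl
    have hDne : D ≠ Set.univ := by
      rintro rfl
      exact hDv trivial
    have hcov : ∀ z, z ≠ v → z ∈ C ∨ z ∈ D := fun z hz => (hCD.union_eq ▸ hz : z ∈ C ∪ D)
    have hGL : ∀ a b, a ≠ v → b ≠ v → L.Adj a b → G.Adj a b := fun a b ha hb h =>
      ⟨h.ne, ha, hb, .inl h⟩
    have hdiff : D \ (C ∩ D) = D \ C := by rw [Set.inter_comm, Set.sdiff_self_inter]
    have hm1 := hm.lt_rho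
    rw [hdiff] at hm1
    have hcmp : u ∉ D \ C → rho G (D \ C) ≤ rho L (D \ C) := fun h =>
      rho_contraction_le h
    -- For `u ∈ C ∩ D`, adding `v` to both sides costs one in the order, which
    -- `IsMinimalPair.rho_le` tolerates. For `u ∈ D \ C`, `(C, D + v)` is rigid. For `u ∈ C \ D`,
    -- `(C + v, D)` contradicts massedness.
    by_cases huD : u ∈ D
    · by_cases huC : u ∈ C
      · have h1 := hcmp fun h => h.2 huC
        have hint : insert v C ∩ insert v D = insert v (C ∩ D) := (Set.insert_inter_distrib _ _ _).symm
        have hvCD : v ∉ C ∩ D := fun h => hCv h.1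
        have hdiff' : insert v D \ insert v C = D \ C := by
          ext z
          simp only [Set.mem_sdiff, Set.mem_insert_iff]
          constructor
          · tauto
          · rintro ⟨hz, hz'⟩
            exact ⟨.inr hz, fun h => h.elim (fun h => hDv (h ▸ hz)) hz'⟩
        have h2 := hmin.rho_le (A := insert v C) (B := insert v D) ⟨?_, ?_, ?_⟩ ?_ ?_
        · rw [hdiff'] at h2
          omega
        · ext z
          by_cases hz : z = v
          · simp [hz]
          · simpa [hz] using hcov z hz
        · rintro a ⟨ha, ha'⟩ b ⟨hb, hb'⟩ hab
          simp only [Set.mem_insert_iff, not_or] at ha ha' hb hb'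
          exact hCD.not_adj a ⟨ha.resolve_left ha'.1, ha'.2⟩ b ⟨hb.resolve_left hb'.1, hb'.2⟩
            (hGL a b ha'.1 hb'.1 hab)
        · exact hCD.subset_left.trans (Set.subset_insert _ _)
        · rw [hint, Set.ncard_insert_of_notMem hvCD]
          omega
        · intro huniv
          refine absurd hlt (not_lt.2 (Set.ncard_le_ncard (fun z hz => ?_) (Set.toFinite _)))
          have hzD : z ∈ insert v D := huniv ▸ Set.mem_univ z
          exact ⟨hCD.subset_left hz, hzD.resolve_left fun h => hv (h ▸ hz)⟩
      · have hint : C ∩ insert v D = C ∩ D := Set.inter_insert_of_notMem hCv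
        refine hmin.not_rigid (A := C) (B := insert v D) ⟨?_, ?_, hCD.subset_left⟩
          ⟨u, .inr huD, huC⟩ ?_
        · ext z
          by_cases hz : z = v
          · simp [hz]
          · simpa [hz] using hcov z hz
        · rintro a ⟨ha, ha'⟩ b ⟨hb, hb'⟩ hab
          have haD : a ∉ D := fun h => ha' (.inr h)
          have hav : a ≠ v := fun h => hCv (h ▸ ha)
          rcases hb with rfl | hb
          · exact hCD.not_adj a ⟨ha, haD⟩ u ⟨huD, huC⟩
              ⟨fun h => huC (h ▸ ha), hav, huv.ne, .inr (.inr ⟨rfl, hab.symm⟩)⟩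
          · exact hCD.not_adj a ⟨ha, haD⟩ b ⟨hb, hb'⟩ (hGL a b hav (fun h => hDv (h ▸ hb)) hab)
        · rw [hint]
          refine (hmin.knittedOn (G := G) hDne Set.inter_subset_right
            (hCD.closed fun x _ y h => h.2.2.1) ?_ hm).lift_contraction Set.inter_subset_right hDv
            huv fun x y h => h.2.2.2
          have := hmin.admissible.ncard_le
          omega
    · have huC : u ∈ C := (hcov u huv.ne).resolve_right huD
      have h1 := hcmp fun h => huD h.1
      have hint : insert v C ∩ D = C ∩ D := Set.insert_inter_of_notMem hDv
      have hdiff' : D \ insert v C = D \ C := by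
        rw [← Set.sdiff_inter_self_eq_sdiff, hint, hdiff]
      have h2 := hmin.massedOn.rho_le (insert v C) D ⟨?_, ?_, ?_⟩ (hint ▸ hlt)
      · rw [hdiff'] at h2
        omega
      · ext z
        by_cases hz : z = v
        · simp [hz]
        · simpa [hz] using hcov z hz
      · rintro a ⟨ha, ha'⟩ b ⟨hb, hb'⟩ hab
        simp only [Set.mem_insert_iff, not_or] at hb'
        rcases ha with rfl | ha
        · exact hCD.not_adj u ⟨huC, huD⟩ b ⟨hb, hb'.2⟩
            ⟨fun h => huD (h ▸ hb), huv.ne, hb'.1, .inr (.inl ⟨rfl, hab⟩)⟩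
        · exact hCD.not_adj a ⟨ha, ha'⟩ b ⟨hb, hb'.2⟩ (hGL a b (fun h => hCv (h ▸ ha)) hb'.1 hab)
      · exact hCD.subset_left.trans (Set.subset_insert _ _)
  have h1 := rho_le_rho_contraction (L := L) (S := S) (u := u) (v := v)
  rw [← hG] at h1
  have h2 := hmin.massedOn.lt_rho
  have h3 : (Set.univ \ S).ncard = ({v}ᶜ \ S).ncard + 1 := by
    rw [← Set.ncard_insert_of_notMem (a := v) (by simp)]
    congr 1
    ext z
    by_cases hz : z = v
    · simp [hz, hv]
    · simp [hz]
  rw [h3, mul_add, mul_one] at h2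
  -- More than `p/2` edges disappear, and `uv` is one of those allowed for, so `2(lost + 1) > p`;
  -- this gives `lost ≥ ⌊p/2⌋`.
  omega

/-! ### Consequences of the extremal choice of edges -/

/-- By maximality of the number of edges inside `S`, the non-adjacent pairs in `S` belong to a
partition of `S` that shows that `(L, S)` is not knitted. -/
theorem IsMinimalPair.exists_unlinked (hmin : IsMinimalPair l p L S) :
    ∃ (ι : Type u) (s t : ι → V),
      (Pairwise fun i j => Disjoint ({s i, t i} : Set V) {s j, t j}) ∧
      ∀ x ∈ S, ∀ y ∈ S, x ≠ y → ¬ L.Adj x y → ∃ i, x ∈ ({s i, t i} : Set V) ∧ y ∈ ({s i, t i} : Set V) := by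
  have hnot := hmin.not_knittedOn
  unfold KnittedOn at hnot
  push Not at hnot
  obtain ⟨ι, s, t, hs, ht, hst, hC⟩ := hnot
  refine ⟨ι, s, t, hst, fun x hx y hy hxy hadj => ?_⟩
  by_contra! hcon
  set G : SimpleGraph V := L ⊔ SimpleGraph.edge x y with hG
  have hGL : ∀ a b, G.Adj a b → L.Adj a b ∨ a = x ∧ b = y ∨ a = y ∧ b = x := by
    intro a b h
    rw [hG, SimpleGraph.sup_adj, SimpleGraph.edge_adj] at h
    tauto
  have hLG : L ≤ G := le_sup_left
  have hrho : ∀ T, Disjoint S T → rho G T = rho L T := by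
    intro T hT
    refine le_antisymm (rho_le_rho fun a ha b h => (hGL a b h).resolve_right ?_)
      (rho_le_rho fun a ha b h => hLG h)
    rintro (⟨rfl, -⟩ | ⟨rfl, -⟩)
    exacts [Set.disjoint_left.1 hT hx ha, Set.disjoint_left.1 hT hy ha]
  have hadm : Admissible l p G S := by
    refine ⟨massed_iff_massedOn_univ.2 ⟨?_, fun C D hCD hlt => ?_⟩, hmin.admissible.ncard_le, ?_⟩
    · rw [hrho _ Set.disjoint_sdiff_right]
      exact hmin.massedOn.lt_rho
    · rw [hrho _ (Set.disjoint_sdiff_right.mono_left hCD.subset_left)]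
      exact hmin.massedOn.rho_le C D ⟨hCD.union_eq, fun a ha b hb h =>
        hCD.not_adj a ha b hb (hLG h), hCD.subset_left⟩ hlt
    -- The new edge is useless for the bad partition: its ends are in different parts, and no
    -- linking set contains terminals of another part.
    · rw [knitted_iff_knittedOn_univ]
      intro hk
      obtain ⟨C, h1, h2, h3, h4⟩ := hk ι s t hs ht hst
      obtain ⟨i, hi⟩ := hC C h1 h2 fun i => (h3 i).map_adj subset_rfl fun a ha b hb h => by
        refine (hGL a b h).resolve_right ?_
        rintro (⟨rfl, rfl⟩ | ⟨rfl, rfl⟩)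
        · exact hcon i (h4 i ⟨ha, hx⟩) (h4 i ⟨hb, hy⟩)
        · exact hcon i (h4 i ⟨hb, hx⟩) (h4 i ⟨ha, hy⟩)
      exact hi (h4 i)
  have hle := hmin.edges_max V G S hadm rfl (hrho _ disjoint_compl_right)
  refine absurd hle (not_le.2 (Set.ncard_lt_ncard ⟨?_, fun h => ?_⟩ (Set.toFinite _)))
  · exact SimpleGraph.edgeSet_mono fun a b h => hLG h
  · have hmem : s((⟨x, hx⟩ : S), ⟨y, hy⟩) ∈ (G.induce S).edgeSet := by
      change G.Adj x y
      rw [hG, SimpleGraph.sup_adj, SimpleGraph.edge_adj]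
      tauto
    exact hadj (h hmem)

/-- Each vertex of `S` has at most one non-neighbour in `S`. -/
theorem IsMinimalPair.eq_of_not_adj (hmin : IsMinimalPair l p L S) {x y z : V} (hx : x ∈ S)
    (hy : y ∈ S) (hz : z ∈ S) (hxy : x ≠ y) (hxz : x ≠ z) (hxy' : ¬ L.Adj x y)
    (hxz' : ¬ L.Adj x z) : y = z := by
  obtain ⟨ι, s, t, hst, h⟩ := hmin.exists_unlinked
  obtain ⟨i, hi, hi'⟩ := h x hx y hy hxy hxy'
  obtain ⟨j, hj, hj'⟩ := h x hx z hz hxz hxz'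
  have hij : i = j := by
    by_contra hij
    exact Set.disjoint_left.1 (hst hij) hi hj
  subst hij
  simp only [Set.mem_insert_iff, Set.mem_singleton_iff] at *
  grind

/-- Moving `x` into `D` as well repairs the deleted edge and raises the order to at most `|S|`,
which `IsMinimalPair.rho_le` still covers. -/
theorem IsMinimalPair.rho_le_of_deleteEdge (hmin : IsMinimalPair l p L S) {M : SimpleGraph V}
    {x y : V} (hM : ∀ a b, M.Adj a b ↔ L.Adj a b ∧ s(a, b) ≠ s(x, y)) {C D : Set V}
    (hxy : L.Adj x y) (hCD : SepOn M Set.univ S C D) (hlt : (C ∩ D).ncard < S.ncard)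
    (hx : x ∈ C \ D) (hy : y ∈ D \ C) : 2 * rho M (D \ C) ≤ p * (D \ C).ncard := by
  have hint : C ∩ insert x D = insert x (C ∩ D) := by
    rw [Set.inter_insert_of_mem hx.1]
  have hxCD : x ∉ C ∩ D := fun h => hx.2 h.2
  have hdiff : insert x D \ C = D \ C := Set.insert_sdiff_of_mem _ hx.1
  have hcov : ∀ z, z ∈ C ∨ z ∈ D := fun z => (hCD.union_eq ▸ Set.mem_univ z : z ∈ C ∪ D)
  -- In this degenerate case `C = S`, and all neighbours of `x` except `y` lie in `S`. Since `|S| <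
  -- ⌊p/2⌋`, contracting `y` into `x` would lose too few edges.
  by_cases huniv : insert x D = Set.univ
  · exfalso
    have hCsub : C = insert x (C ∩ D) := by
      rw [← hint, huniv, Set.inter_univ]
    have hCS : S = C := by
      apply Set.eq_of_subset_of_ncard_le hCD.subset_left
      rw [hCsub, Set.ncard_insert_of_notMem hxCD]
      omega
    have hle := hmin.le_ncard_lostVertices hxy (hCS ▸ hy.2)
    have hsub : lostVertices L S x y ⊆ S \ {x} := by
      rintro w ⟨hwx, hyw, hw⟩
      refine ⟨?_, hwx⟩
      rcases hw with hw | hw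
      · by_contra hwS
        have hwC : w ∉ C := hCS ▸ hwS
        refine hCD.not_adj x hx w ⟨(hcov w).resolve_left hwC, hwC⟩ ((hM x w).2 ⟨hw, fun h => ?_⟩)
        rw [Sym2.eq_iff] at h
        rcases h with ⟨-, rfl⟩ | ⟨-, h⟩
        exacts [hyw.ne rfl, hwx h]
      · exact hw.2
    have h1 := Set.ncard_le_ncard hsub (Set.toFinite _)
    have h2 := Set.ncard_sdiff_singleton_le S x
    have h3 := hmin.ncard_lt
    omega
  · have h1 := hmin.rho_le (A := C) (B := insert x D) ⟨?_, ?_, hCD.subset_left⟩ ?_ huniv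
    · rw [hdiff] at h1
      have h2 : rho M (D \ C) ≤ rho L (D \ C) := rho_le_rho fun a _ b h => ((hM a b).1 h).1
      omega
    · exact Set.eq_univ_of_forall fun z => (hcov z).imp_right (.inr ·)
    · rintro a ⟨ha, ha'⟩ b hb hab
      rw [hdiff] at hb
      simp only [Set.mem_insert_iff, not_or] at ha'
      refine hCD.not_adj a ⟨ha, ha'.2⟩ b hb ((hM a b).2 ⟨hab, fun h => ?_⟩)
      rw [Sym2.eq_iff] at h
      rcases h with ⟨h, -⟩ | ⟨-, h⟩
      exacts [ha'.1 h, hb.2 (h ▸ hx.1)]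
    · rw [hint, Set.ncard_insert_of_notMem hxCD]
      omega

/-- With a larger `rho`, an edge not inside `S` could be deleted and the pair would remain
admissible. -/
theorem IsMinimalPair.rho_le_add_two (hmin : IsMinimalPair l p L S) :
    2 * rho L (Set.univ \ S) ≤ p * (Set.univ \ S).ncard + 2 := by
  by_contra! hcon
  have hne : {e ∈ L.edgeSet | ∃ v ∈ Set.univ \ S, v ∈ e}.Nonempty := by
    rw [Set.nonempty_iff_ne_empty]
    intro h
    rw [rho, h, Set.ncard_empty] at hcon
    omega
  obtain ⟨e, he⟩ := hne
  induction e with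
  | h u v =>
  obtain ⟨huv, huvS⟩ := mem_rho_set.1 he
  set M := L.deleteEdges {s(u, v)} with hMdef
  have hM : ∀ a b, M.Adj a b ↔ L.Adj a b ∧ s(a, b) ≠ s(u, v) := by
    intro a b
    simp [hMdef, SimpleGraph.deleteEdges_adj]
  have hM' : ∀ a b, M.Adj a b ↔ L.Adj a b ∧ s(a, b) ≠ s(v, u) := by
    rwa [Sym2.eq_swap]
  have hrho : {e ∈ M.edgeSet | ∃ v ∈ Set.univ \ S, v ∈ e} =
      {e ∈ L.edgeSet | ∃ v ∈ Set.univ \ S, v ∈ e} \ {s(u, v)} := by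
    ext e
    rw [hMdef, SimpleGraph.edgeSet_deleteEdges]
    simp only [Set.mem_ofPred_eq, Set.mem_sdiff]
    tauto
  have hrho1 : rho M (Set.univ \ S) + 1 = rho L (Set.univ \ S) := by
    rw [rho, hrho]
    exact Set.ncard_sdiff_singleton_add_one he (Set.toFinite _)
  have hadm : Admissible l p M S := by
    refine ⟨massed_iff_massedOn_univ.2 ⟨by omega, fun C D hCD hlt => ?_⟩,
      hmin.admissible.ncard_le, ?_⟩
    · by_cases h1 : u ∈ C \ D ∧ v ∈ D \ C
      · exact hmin.rho_le_of_deleteEdge hM huv hCD hlt h1.1 h1.2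
      by_cases h2 : v ∈ C \ D ∧ u ∈ D \ C
      · exact hmin.rho_le_of_deleteEdge hM' huv.symm hCD hlt h2.1 h2.2
      have h3 := hmin.massedOn.rho_le C D ⟨hCD.union_eq, fun a ha b hb hab => ?_,
        hCD.subset_left⟩ hlt
      · have h4 : rho M (D \ C) ≤ rho L (D \ C) := rho_le_rho fun a _ b h => ((hM a b).1 h).1
        omega
      · refine hCD.not_adj a ha b hb ((hM a b).2 ⟨hab, fun h => ?_⟩)
        rw [Sym2.eq_iff] at h
        rcases h with ⟨rfl, rfl⟩ | ⟨rfl, rfl⟩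
        exacts [h1 ⟨ha, hb⟩, h2 ⟨ha, hb⟩]
    · rw [knitted_iff_knittedOn_univ]
      intro hk
      refine hmin.not_knittedOn fun ι s t hs ht hst => ?_
      obtain ⟨C, g1, g2, g3, g4⟩ := hk ι s t hs ht hst
      exact ⟨C, g1, g2, fun i => (g3 i).map_adj subset_rfl fun a _ b _ h => ((hM a b).1 h).1, g4⟩
  have := hmin.rho_min V M S hadm rfl
  rw [Set.compl_eq_univ_sdiff] at this
  omega

end

/-! ### Degree sums and the closed neighbourhood of a vertex -/

open Classical in
theorem sum_neighborSet_ncard [Fintype V] (L : SimpleGraph V) (S : Set V) :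
    ∑ v with v ∉ S, ((L.neighborSet v).ncard + (L.neighborSet v ∩ S).ncard) =
      2 * rho L (Set.univ \ S) := by
  let K : SimpleGraph V :=
    { Adj := fun x y => L.Adj x y ∧ (x ∉ S ∨ y ∉ S)
      symm := ⟨fun _ _ h => ⟨h.1.symm, h.2.symm⟩⟩
      loopless := ⟨fun _ h => h.1.ne rfl⟩ }
  have hrho : rho L (Set.univ \ S) = K.edgeFinset.card := by
    rw [← Set.ncard_coe_finset, SimpleGraph.coe_edgeFinset, rho]
    congr 1
    ext e
    induction e with
    | h a b =>
      rw [mem_rho_set]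
      simp [K]
  rw [hrho, ← K.sum_degrees_eq_twice_card_edges,
    ← Finset.sum_filter_add_sum_filter_not Finset.univ (fun v => v ∉ S) fun v => K.degree v,
    Finset.sum_add_distrib]
  congr 1
  · refine Finset.sum_congr rfl fun v hv => ?_
    have hv : v ∉ S := by simpa using hv
    rw [← K.card_neighborSet_eq_degree, ← Nat.card_eq_fintype_card, Nat.card_coe_set_eq]
    congr 1
    ext w
    simp [K, hv]
  · have h1 : ∀ v, (L.neighborSet v ∩ S).ncard =
        (Finset.bipartiteAbove L.Adj {w | ¬ w ∉ S} v).card := by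
      intro v
      rw [← Set.ncard_coe_finset]
      congr 1
      ext w
      simp [Finset.bipartiteAbove, and_comm]
    have h2 : ∀ w ∈ Finset.univ.filter fun w => ¬ w ∉ S, K.degree w =
        (Finset.bipartiteBelow L.Adj {v | v ∉ S} w).card := by
      intro w hw
      have hw : w ∈ S := by simpa using hw
      rw [← K.card_neighborSet_eq_degree, ← Nat.card_eq_fintype_card, Nat.card_coe_set_eq,
        ← Set.ncard_coe_finset]
      congr 1
      ext v
      simp [K, hw, Finset.bipartiteBelow, L.adj_comm v w, and_comm]
    rw [Finset.sum_congr rfl h2, Finset.sum_congr rfl fun v _ => h1 v]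
    exact Finset.sum_card_bipartiteAbove_eq_sum_card_bipartiteBelow _

theorem le_minDeg {W : Type u} [Finite W] [Nonempty W] {H : SimpleGraph W} {k : ℕ}
    (h : ∀ w, k ≤ (H.neighborSet w).ncard) : k ≤ minDeg H := by
  classical
  let _ := Fintype.ofFinite W
  refine SimpleGraph.le_minDegree_of_forall_le_degree H k fun w => ?_
  rw [← H.card_neighborSet_eq_degree, ← Nat.card_eq_fintype_card, Nat.card_coe_set_eq]
  exact h w

theorem ncard_neighborSet_induce (L : SimpleGraph V) (X : Set V) (w : X) :
    ((L.induce X).neighborSet w).ncard = (X ∩ L.neighborSet w).ncard := by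
  rw [← Set.ncard_image_of_injective _ Subtype.val_injective]
  congr 1
  ext z
  simp [and_comm]

/-- The neighbours of `v` in `S` that have a non-neighbour among the neighbours of `v` in `S`. -/
def pairedNeighbors (L : SimpleGraph V) (S : Set V) (v : V) : Set V :=
  {w | w ∈ L.neighborSet v ∩ S ∧ ∃ z ∈ L.neighborSet v ∩ S, w ≠ z ∧ ¬ L.Adj w z}

section
variable [Finite V] {l p : ℕ} {L : SimpleGraph V} {S : Set V} {v : V}

theorem IsMinimalPair.exists_adj (hmin : IsMinimalPair l p L S) (hv : v ∉ S) :
    ∃ w, L.Adj v w := by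
  by_contra! hcon
  refine hmin.not_rigid (A := {v}ᶜ) (B := {v}) ⟨Set.compl_union_self _, ?_, fun z hz h => hv (h ▸ hz)⟩
    ⟨v, rfl, by simp⟩ ?_
  · rintro a - b ⟨hb, -⟩ hab
    exact hcon a (hb ▸ hab.symm)
  · rw [Set.compl_inter_self]
    intro ι s t hs _ _
    exact ⟨fun _ => ∅, fun i => (hs i).elim, fun i => (hs i).elim, fun i => (hs i).elim,
      fun i => (hs i).elim⟩

theorem IsMinimalPair.lt_ncard_neighborSet (hmin : IsMinimalPair l p L S) (hv : v ∉ S) :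
    p / 2 + 1 ≤ (L.neighborSet v).ncard := by
  obtain ⟨w, hw⟩ := hmin.exists_adj hv
  have h1 := hmin.le_ncard_lostVertices hw.symm hv
  have hsub : lostVertices L S w v ⊆ L.neighborSet v \ {w} := fun z hz => ⟨hz.2.1, hz.1⟩
  have h2 := Set.ncard_le_ncard hsub (Set.toFinite _)
  have h3 := Set.ncard_sdiff_singleton_add_one (s := L.neighborSet v) hw (Set.toFinite _)
  omega

/-- A vertex lost in contracting `v` into `w` is a neighbour of `w` unless both form a non-adjacent
pair in `S`, which is excluded here. The vertex `v` itself adds one. -/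
theorem IsMinimalPair.lt_ncard_closedNbhd (hmin : IsMinimalPair l p L S) (hv : v ∉ S) {w : V}
    (hw : w ∈ insert v (L.neighborSet v)) (hwU : w ∉ pairedNeighbors L S v) :
    p / 2 + 1 ≤ (insert v (L.neighborSet v) ∩ L.neighborSet w).ncard := by
  rcases hw with rfl | hw
  · refine (hmin.lt_ncard_neighborSet hv).trans (Set.ncard_le_ncard ?_ (Set.toFinite _))
    exact Set.subset_inter (Set.subset_insert _ _) subset_rfl
  · have h1 := hmin.le_ncard_lostVertices (SimpleGraph.Adj.symm hw) hv
    have hvn : v ∉ lostVertices L S w v := fun h => h.2.1.ne rfl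
    have hsub : insert v (lostVertices L S w v) ⊆
        insert v (L.neighborSet v) ∩ L.neighborSet w := by
      rintro z (rfl | ⟨hzw, hvz, hz⟩)
      · exact ⟨.inl rfl, SimpleGraph.Adj.symm hw⟩
      · refine ⟨.inr hvz, ?_⟩
        by_contra hwz
        have hS := hz.resolve_left hwz
        exact hwU ⟨⟨hw, hS.1⟩, z, ⟨hvz, hS.2⟩, hzw.symm, hwz⟩
    have h2 := Set.ncard_le_ncard hsub (Set.toFinite _)
    rw [Set.ncard_insert_of_notMem hvn] at h2
    omega

/-- A paired `w` has only one non-neighbour in `S`, so a single lost vertex is discarded, and `v`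
makes up for it. -/
theorem IsMinimalPair.le_ncard_closedNbhd (hmin : IsMinimalPair l p L S) (hv : v ∉ S) {w : V}
    (hw : w ∈ insert v (L.neighborSet v)) :
    p / 2 ≤ (insert v (L.neighborSet v) ∩ L.neighborSet w).ncard := by
  by_cases hwU : w ∈ pairedNeighbors L S v
  · obtain ⟨⟨hvw, hwS⟩, t, ⟨hvt, htS⟩, hwt, hadj⟩ := hwU
    have h1 := hmin.le_ncard_lostVertices (SimpleGraph.Adj.symm hvw) hv
    have hsub : insert v (lostVertices L S w v \ {t}) ⊆
        insert v (L.neighborSet v) ∩ L.neighborSet w := by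
      rintro z (rfl | ⟨⟨hzw, hvz, hz⟩, hzt⟩)
      · exact ⟨.inl rfl, SimpleGraph.Adj.symm hvw⟩
      · refine ⟨.inr hvz, ?_⟩
        by_contra hwz
        exact hzt (hmin.eq_of_not_adj hwS (hz.resolve_left hwz).2 htS hzw.symm hwt hwz hadj)
    have hvn : v ∉ lostVertices L S w v \ {t} := fun h => h.1.2.1.ne rfl
    have h2 := Set.ncard_le_ncard hsub (Set.toFinite _)
    rw [Set.ncard_insert_of_notMem hvn] at h2
    have h3 := Set.le_ncard_sdiff {t} (lostVertices L S w v)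
    rw [Set.ncard_singleton] at h3
    omega
  · exact (Nat.le_succ _).trans (hmin.lt_ncard_closedNbhd hv hw hwU)

theorem pairedNeighbors_isIndepSet (h : (pairedNeighbors L S v).ncard ≤ 2) :
    L.IsIndepSet (pairedNeighbors L S v) := by
  intro a ha b hb hab
  obtain ⟨ha', z, hz, haz, hadj⟩ := ha
  by_contra hab'
  have hzb : b ≠ z := by
    rintro rfl
    exact hadj hab'
  have hsub : ({a, b, z} : Set V) ⊆ pairedNeighbors L S v := by
    rintro x (rfl | rfl | rfl)
    · exact ⟨ha', z, hz, haz, hadj⟩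
    · exact hb
    · exact ⟨hz, a, ha', haz.symm, fun h => hadj h.symm⟩
  have h1 := Set.ncard_le_ncard hsub (Set.toFinite _)
  rw [Set.ncard_eq_three.2 ⟨a, b, z, hab, haz, hzb, rfl⟩] at h1
  omega

theorem IsMinimalPair.dense_closedNbhd (hmin : IsMinimalPair l p L S) (hv : v ∉ S)
    (h : (pairedNeighbors L S v = ∅ ∧ (L.neighborSet v).ncard + 1 ≤ p) ∨
      ((pairedNeighbors L S v).ncard ≤ 2 ∧ (L.neighborSet v).ncard + 3 ≤ p) ∨
      (L.neighborSet v).ncard + 5 ≤ p) :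
    (Nat.card ↥(insert v (L.neighborSet v)) ≤ p ∧ p / 2 + 1 ≤ minDeg (closedNbhdGraph L v)) ∨
    (((Nat.card ↥(insert v (L.neighborSet v)) : ℕ) : ℤ) ≤ (p : ℤ) - 2 ∧
      p / 2 ≤ minDeg (closedNbhdGraph L v) ∧
      (verticesOfDegree (closedNbhdGraph L v) (p / 2)).ncard ≤ 2 ∧
      (closedNbhdGraph L v).IsIndepSet (verticesOfDegree (closedNbhdGraph L v) (p / 2))) ∨
    (((Nat.card ↥(insert v (L.neighborSet v)) : ℕ) : ℤ) ≤ (p : ℤ) - 4 ∧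
      p / 2 ≤ minDeg (closedNbhdGraph L v)) := by
  have hcard : Nat.card ↥(insert v (L.neighborSet v)) = (L.neighborSet v).ncard + 1 := by
    rw [Nat.card_coe_set_eq, Set.ncard_insert_of_notMem (show v ∉ L.neighborSet v by simp)]
  have : Nonempty ↥(insert v (L.neighborSet v)) := ⟨⟨v, .inl rfl⟩⟩
  have hmindeg : p / 2 ≤ minDeg (closedNbhdGraph L v) := le_minDeg fun w => by
    rw [ncard_neighborSet_induce]
    exact hmin.le_ncard_closedNbhd hv w.2
  rw [hcard]
  rcases h with ⟨hU, h⟩ | ⟨hU, h⟩ | h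
  · refine .inl ⟨h, le_minDeg fun w => ?_⟩
    rw [ncard_neighborSet_induce]
    exact hmin.lt_ncard_closedNbhd hv w.2 (hU ▸ Set.notMem_empty _)
  · have hsub : ∀ w ∈ verticesOfDegree (closedNbhdGraph L v) (p / 2),
        (w : V) ∈ pairedNeighbors L S v := by
      intro w hw
      by_contra hwU
      have h1 := hmin.lt_ncard_closedNbhd hv w.2 hwU
      rw [← ncard_neighborSet_induce] at h1
      change p / 2 + 1 ≤ ((closedNbhdGraph L v).neighborSet w).ncard at h1
      change ((closedNbhdGraph L v).neighborSet w).ncard = p / 2 at hw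
      omega
    refine .inr (.inl ⟨by omega, hmindeg, ?_, ?_⟩)
    · rw [← Set.ncard_image_of_injective _ Subtype.val_injective]
      refine (Set.ncard_le_ncard ?_ (Set.toFinite _)).trans hU
      rintro _ ⟨w, hw, rfl⟩
      exact hsub w hw
    · intro a ha b hb hab
      exact pairedNeighbors_isIndepSet hU (hsub a ha) (hsub b hb) fun h => hab (Subtype.ext h)
  · exact .inr (.inr ⟨by omega, hmindeg⟩)

/-! ### Common neighbours and the choice of the vertex -/

/-- A vertex of `S` and a neighbour of it outside `S` have many common neighbours outside `S`. -/
theorem IsMinimalPair.ncard_outside_add (hmin : IsMinimalPair l p L S) (hv : v ∉ S) {s : V}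
    (hs : s ∈ S) (hsv : L.Adj s v) :
    S.ncard + 3 ≤ (L.neighborSet s \ S).ncard + (L.neighborSet v ∩ S).ncard := by
  have h1 := hmin.le_ncard_lostVertices hsv hv
  have hsub : lostVertices L S s v ⊆
      ((L.neighborSet s \ S) \ {v}) ∪ ((L.neighborSet v ∩ S) \ {s}) := by
    rintro z ⟨hzs, hvz, hz⟩
    by_cases hzS : z ∈ S
    · exact .inr ⟨⟨hvz, hzS⟩, hzs⟩
    · exact .inl ⟨⟨hz.resolve_right fun h => hzS h.2, hzS⟩, hvz.ne'⟩
  have h2 := (Set.ncard_le_ncard hsub (Set.toFinite _)).trans (Set.ncard_union_le _ _)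
  have h3 := Set.ncard_sdiff_singleton_add_one (s := L.neighborSet s \ S) ⟨hsv, hv⟩ (Set.toFinite _)
  have h4 := Set.ncard_sdiff_singleton_add_one (s := L.neighborSet v ∩ S) ⟨hsv.symm, hs⟩
    (Set.toFinite _)
  have h5 := hmin.ncard_lt
  omega

/-- Otherwise `(S, V \ {s})` would be a separation of order `|S| - 1` whose new part is all of `V \
S`, against massedness. -/
theorem IsMinimalPair.exists_adj_outside (hmin : IsMinimalPair l p L S) {s : V} (hs : s ∈ S) :
    ∃ v ∉ S, L.Adj s v := by
  by_contra! hcon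
  have hdiff : ({s}ᶜ : Set V) \ S = Set.univ \ S := by
    ext z
    simp only [Set.mem_sdiff, Set.mem_compl_iff, Set.mem_singleton_iff, Set.mem_univ, true_and]
    exact ⟨fun h => h.2, fun h => ⟨fun h' => h (h' ▸ hs), h⟩⟩
  have h1 := hmin.massedOn.rho_le S {s}ᶜ ⟨?_, ?_, subset_rfl⟩ ?_
  · have h2 := hmin.massedOn.lt_rho
    rw [hdiff] at h1
    omega
  · ext z
    by_cases hz : z = s <;> simp [hz, hs]
  · rintro a ⟨-, ha⟩ b ⟨-, hb⟩ hab
    have has : a = s := by simpa using ha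
    exact hcon b hb (has ▸ hab)
  · rw [← Set.sdiff_eq]
    exact Set.ncard_sdiff_singleton_lt_of_mem hs (Set.toFinite _)

/-- If each non-adjacent pair in `S` has sufficiently many common neighbours outside `S`, then
`(L, S)` is knitted. -/
theorem knittedOn_of_commonNeighbors
    (h : ∀ s ∈ S, ∀ t ∈ S, s ≠ t → ¬ L.Adj s t →
      3 ≤ {v | v ∉ S ∧ L.Adj v s ∧ L.Adj v t}.ncard ∧
      S.ncard ≤ {v | v ∉ S ∧ L.Adj v s ∧ L.Adj v t}.ncard + 4) : KnittedOn L Set.univ S := by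
  classical
  intro ι s t hs ht hst
  have hne : ∀ i j, i ≠ j → s i ≠ s j ∧ s i ≠ t j ∧ t i ≠ t j := by
    intro i j hij
    have := hst hij
    simp only [Set.disjoint_insert_left, Set.disjoint_singleton_left, Set.mem_insert_iff,
      Set.mem_singleton_iff] at this
    tauto
  let J := {i : ι // s i ≠ t i ∧ ¬ L.Adj (s i) (t i)}
  -- Each non-adjacent pair uses two vertices of `S`, hence `2|J| ≤ |S|`.
  let f : J × Bool → S := fun q => if q.2 then ⟨s q.1, hs _⟩ else ⟨t q.1, ht _⟩
  have hf : Function.Injective f := by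
    rintro ⟨⟨i, hi⟩, b⟩ ⟨⟨j, hj⟩, c⟩ hij
    have hval : (if b then s i else t i) = if c then s j else t j := by
      have := congrArg Subtype.val hij
      simpa only [f, apply_ite Subtype.val] using this
    by_cases hij' : i = j
    · subst hij'
      cases b <;> cases c
      exacts [rfl, absurd hval.symm hi.1, absurd hval hi.1, rfl]
    · have h1 := hne i j hij'
      have h2 := hne j i (Ne.symm hij')
      cases b <;> cases c
      exacts [absurd hval h1.2.2, absurd hval.symm h2.2.1, absurd hval h1.2.1, absurd hval h1.1]
  have : Finite (J × Bool) := Finite.of_injective f hf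
  have : Finite J := Finite.of_surjective (Prod.fst : J × Bool → J) Prod.fst_surjective
  let _ := Fintype.ofFinite J
  have hJ : Nat.card J * 2 ≤ S.ncard := by
    have := Nat.card_le_card_of_injective f hf
    rwa [Nat.card_prod, Nat.card_coe_set_eq, Nat.card_eq_fintype_card (α := Bool),
      Fintype.card_bool] at this
  let W : J → Finset V := fun i =>
    (Set.toFinite {v | v ∉ S ∧ L.Adj v (s i) ∧ L.Adj v (t i)}).toFinset
  obtain ⟨c, hcinj, hcW⟩ := (Finset.all_card_le_biUnion_card_iff_exists_injective W).1 (by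
    intro F
    rcases F.eq_empty_or_nonempty with rfl | ⟨i, hi⟩
    · simp
    · have h1 := h (s i) (hs _) (t i) (ht _) i.2.1 i.2.2
      rw [Set.ncard_eq_toFinset_card _ (Set.toFinite _)] at h1
      change 3 ≤ (W i).card ∧ S.ncard ≤ (W i).card + 4 at h1
      have h2 := Finset.card_le_card (Finset.subset_biUnion_of_mem W hi)
      have h3 := Finset.card_le_univ F
      rw [← Nat.card_eq_fintype_card] at h3
      -- With `w ≥ 3` common neighbours and `|S| ≤ w + 4`, the number of pairs is at most `⌊(w +
      -- 4)/2⌋ ≤ w`, so Hall's condition holds.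
      omega)
  have hc : ∀ i, c i ∉ S ∧ L.Adj (c i) (s i) ∧ L.Adj (c i) (t i) := fun i => by
    simpa [W] using hcW i
  refine ⟨fun i => {s i, t i} ∪ {z | ∃ h, z = c ⟨i, h⟩}, fun i => Set.subset_univ _, ?_, ?_, ?_⟩
  · intro i j hij
    have hS : ∀ k, ∀ z ∈ ({s k, t k} : Set V), z ∈ S := by
      rintro k z (rfl | rfl)
      exacts [hs k, ht k]
    refine Set.disjoint_left.2 ?_
    rintro z (hz | ⟨h, hz⟩) (hz' | ⟨h', hz'⟩)
    · exact Set.disjoint_left.1 (hst hij) hz hz'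
    · exact (hc ⟨j, h'⟩).1 (hz' ▸ hS i z hz)
    · exact (hc ⟨i, h⟩).1 (hz ▸ hS j z hz')
    · exact hij (congrArg Subtype.val (hcinj (hz.symm.trans hz')))
  · intro i
    have hsi : s i ∈ ({s i, t i} ∪ {z | ∃ h, z = c ⟨i, h⟩} : Set V) := .inl (.inl rfl)
    have hti : t i ∈ ({s i, t i} ∪ {z | ∃ h, z = c ⟨i, h⟩} : Set V) := .inl (.inr rfl)
    by_cases h : s i ≠ t i ∧ ¬ L.Adj (s i) (t i)
    · have hci : c ⟨i, h⟩ ∈ ({s i, t i} ∪ {z | ∃ h, z = c ⟨i, h⟩} : Set V) := .inr ⟨h, rfl⟩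
      exact (JoinedIn.of_adj (hc ⟨i, h⟩).2.2 hci hti).cons (hc ⟨i, h⟩).2.1.symm hsi
    · by_cases heq : s i = t i
      · exact heq ▸ JoinedIn.refl hsi
      · exact .of_adj (by tauto) hsi hti
  · rintro i z ⟨hz | ⟨h, rfl⟩, hzS⟩
    exacts [hz, absurd hzS (hc _).1]

/-- The non-edges of `S` form a matching, and the paired neighbours are a union of its pairs. -/
theorem IsMinimalPair.pairedNeighbors_ncard (hmin : IsMinimalPair l p L S) (v : V) :
    pairedNeighbors L S v = ∅ ∨ (pairedNeighbors L S v).ncard = 2 ∨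
      4 ≤ (pairedNeighbors L S v).ncard := by
  set U := pairedNeighbors L S v with hU
  have hmate : ∀ a ∈ U, ∃ b ∈ U, a ≠ b ∧ ¬ L.Adj a b := by
    rintro a ⟨ha, b, hb, hab, hadj⟩
    exact ⟨b, ⟨hb, a, ha, hab.symm, fun h => hadj h.symm⟩, hab, hadj⟩
  have huniq : ∀ a ∈ U, ∀ b ∈ U, ∀ c ∈ U, a ≠ b → a ≠ c → ¬ L.Adj a b → ¬ L.Adj a c → b = c :=
    fun a ha b hb c hc => hmin.eq_of_not_adj ha.1.2 hb.1.2 hc.1.2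
  rcases U.eq_empty_or_nonempty with h | ⟨a, ha⟩
  · exact .inl h
  obtain ⟨b, hb, hab, hab'⟩ := hmate a ha
  by_cases h : U ⊆ {a, b}
  · have hUab : U = {a, b} := h.antisymm (Set.insert_subset ha (Set.singleton_subset_iff.2 hb))
    exact .inr (.inl (hUab ▸ Set.ncard_pair hab))
  · obtain ⟨c, hc, hcab⟩ := Set.not_subset.1 h
    simp only [Set.mem_insert_iff, Set.mem_singleton_iff, not_or] at hcab
    obtain ⟨d, hd, hcd, hcd'⟩ := hmate c hc
    have hda : d ≠ a := by
      rintro rfl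
      exact hcab.2 (huniq d hd c hc b hb hcd.symm hab (fun h => hcd' h.symm) hab')
    have hdb : d ≠ b := by
      rintro rfl
      exact hcab.1 (huniq d hd c hc a ha hcd.symm hab.symm (fun h => hcd' h.symm)
        fun h => hab' h.symm)
    have hsub : ({c, d} ∪ {a, b} : Set V) ⊆ U := by
      rintro z ((rfl | rfl) | (rfl | rfl)) <;> assumption
    have hle := Set.ncard_le_ncard hsub (Set.toFinite _)
    rw [Set.ncard_union_eq (by
      simp only [Set.disjoint_insert_left, Set.disjoint_singleton_left, Set.mem_insert_iff,
        Set.mem_singleton_iff]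
      tauto), Set.ncard_pair hcd, Set.ncard_pair hab] at hle
    exact .inr (.inr hle)

/-- If the closed neighbourhood of `v` is not small and dense, then `deg v + |N(v) ∩ S| ≥ p`, with
equality only if `N(v) ∩ S` consists of non-adjacent pairs. -/
theorem IsMinimalPair.excess (hmin : IsMinimalPair l p L S)
    (h : ¬ ((pairedNeighbors L S v = ∅ ∧ (L.neighborSet v).ncard + 1 ≤ p) ∨
      ((pairedNeighbors L S v).ncard ≤ 2 ∧ (L.neighborSet v).ncard + 3 ≤ p) ∨
      (L.neighborSet v).ncard + 5 ≤ p)) :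
    p ≤ (L.neighborSet v).ncard + (L.neighborSet v ∩ S).ncard ∧
      ((L.neighborSet v).ncard + (L.neighborSet v ∩ S).ncard ≤ p →
        L.neighborSet v ∩ S ⊆ pairedNeighbors L S v) ∧ p ≤ (L.neighborSet v).ncard + 4 := by
  have hsub : pairedNeighbors L S v ⊆ L.neighborSet v ∩ S := fun w hw => hw.1
  have hle := Set.ncard_le_ncard hsub (Set.toFinite _)
  push Not at h
  obtain ⟨h0, h2, h4⟩ := h
  have key : p ≤ (L.neighborSet v).ncard + (pairedNeighbors L S v).ncard := by
    rcases hmin.pairedNeighbors_ncard v with h' | h' | h'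
    · have := h0 h'
      omega
    · have := h2 h'.le
      omega
    · omega
  refine ⟨by omega, fun hp => ?_, by omega⟩
  exact (Set.eq_of_subset_of_ncard_le hsub (by omega) (Set.toFinite _)).symm.subset

/-- By `IsMinimalPair.ncard_outside_add`, `s` has at least `|S| + 3 - |N(v) ∩ S|` neighbours outside
`S`. If one of them misses `t`, that one is taken as `v`: then `|N(v) ∩ S| < |S|`, which compensates
for its loss. -/
theorem IsMinimalPair.commonNeighbors_of_excess (hmin : IsMinimalPair l p L S)
    (hexc : ∀ v ∉ S, (L.neighborSet v ∩ S).ncard ≤ 6) {s t : V} (hs : s ∈ S) (ht : t ∈ S)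
    (hbad : {v | v ∉ S ∧ L.Adj v s ∧ ¬ L.Adj v t}.ncard ≤ 1) :
    3 ≤ {v | v ∉ S ∧ L.Adj v s ∧ L.Adj v t}.ncard ∧
      S.ncard ≤ {v | v ∉ S ∧ L.Adj v s ∧ L.Adj v t}.ncard + 4 := by
  set W := {v | v ∉ S ∧ L.Adj v s ∧ L.Adj v t}
  set Z := {v | v ∉ S ∧ L.Adj v s ∧ ¬ L.Adj v t} with hZ
  have hle : (L.neighborSet s \ S).ncard ≤ W.ncard + Z.ncard := by
    refine (Set.ncard_le_ncard (fun v hv => ?_) (Set.toFinite _)).trans (Set.ncard_union_le W Z)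
    by_cases hvt : L.Adj v t
    · exact .inl ⟨hv.2, SimpleGraph.Adj.symm hv.1, hvt⟩
    · exact .inr ⟨hv.2, SimpleGraph.Adj.symm hv.1, hvt⟩
  rcases Z.eq_empty_or_nonempty with hZe | ⟨v, hv⟩
  · obtain ⟨v, hvS, hsv⟩ := hmin.exists_adj_outside hs
    have h1 := hmin.ncard_outside_add hvS hs hsv
    have h2 := hexc v hvS
    have h3 : (L.neighborSet v ∩ S).ncard ≤ S.ncard :=
      Set.ncard_le_ncard Set.inter_subset_right (Set.toFinite _)
    rw [hZe, Set.ncard_empty] at hle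
    omega
  · have h1 := hmin.ncard_outside_add hv.1 hs hv.2.1.symm
    have h2 := hexc v hv.1
    have h3 : (L.neighborSet v ∩ S).ncard < S.ncard :=
      Set.ncard_lt_ncard ⟨Set.inter_subset_right, fun h => hv.2.2 (h ht).1⟩ (Set.toFinite _)
    omega

theorem IsMinimalPair.exists_good_vertex (hmin : IsMinimalPair l p L S) :
    ∃ v ∉ S, (pairedNeighbors L S v = ∅ ∧ (L.neighborSet v).ncard + 1 ≤ p) ∨
      ((pairedNeighbors L S v).ncard ≤ 2 ∧ (L.neighborSet v).ncard + 3 ≤ p) ∨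
      (L.neighborSet v).ncard + 5 ≤ p := by
  classical
  by_contra! hcon
  let _ := Fintype.ofFinite V
  set e : V → ℕ := fun v => (L.neighborSet v).ncard + (L.neighborSet v ∩ S).ncard with he
  have hexc : ∀ v ∉ S, p ≤ e v ∧ (e v ≤ p → L.neighborSet v ∩ S ⊆ pairedNeighbors L S v) ∧
      p ≤ (L.neighborSet v).ncard + 4 := fun v hv => hmin.excess (by
    have := hcon v hv
    push Not
    exact this)
  have hsum : ∑ v with v ∉ S, (e v - p) ≤ 2 := by
    have h1 := sum_neighborSet_ncard L S
    have h2 := hmin.rho_le_add_two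
    have h3 : (Set.univ \ S).ncard = (Finset.univ.filter (· ∉ S)).card := by
      rw [← Set.ncard_coe_finset]
      congr 1
      ext z
      simp
    have h4 : ∑ v with v ∉ S, e v = ∑ v with v ∉ S, (e v - p) + p * (Set.univ \ S).ncard := by
      rw [h3, mul_comm, ← smul_eq_mul, ← Finset.sum_const, ← Finset.sum_add_distrib]
      refine Finset.sum_congr rfl fun v hv => ?_
      have := (hexc v (by simpa using hv)).1
      omega
    change ∑ v with v ∉ S, e v = _ at h1
    omega
  have hle : ∀ v ∉ S, e v ≤ p + 2 := by
    intro v hv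
    have := Finset.single_le_sum (f := fun v => e v - p) (s := Finset.univ.filter (· ∉ S))
      (fun _ _ => Nat.zero_le _) (Finset.mem_filter.2 ⟨Finset.mem_univ v, hv⟩)
    omega
  have hB : {v | v ∉ S ∧ p < e v}.ncard ≤ 2 := by
    refine le_trans ?_ hsum
    have h1 : {v | v ∉ S ∧ p < e v} = ↑((Finset.univ.filter (· ∉ S)).filter (p < e ·)) := by
      ext z
      simp
    rw [h1, Set.ncard_coe_finset, Finset.card_filter]
    refine Finset.sum_le_sum fun v _ => ?_
    split_ifs <;> omega
  refine hmin.not_knittedOn (knittedOn_of_commonNeighbors fun s hs t ht hst hadj => ?_)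
  -- At a vertex without excess, `s` is paired inside `N(v) ∩ S`, and its partner can only be `t`.
  have hbad : ∀ s ∈ S, ∀ t ∈ S, s ≠ t → ¬ L.Adj s t →
      {v | v ∉ S ∧ L.Adj v s ∧ ¬ L.Adj v t} ⊆ {v | v ∉ S ∧ p < e v} := by
    rintro s hs t ht hst hadj v ⟨hv, hvs, hvt⟩
    refine ⟨hv, lt_of_not_ge fun hev => ?_⟩
    obtain ⟨-, z, hz, hsz, hadj'⟩ := (hexc v hv).2.1 hev ⟨hvs, hs⟩
    exact hvt (hmin.eq_of_not_adj hs ht hz.2 hst hsz hadj hadj' ▸ hz.1)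
  have hS6 : ∀ v ∉ S, (L.neighborSet v ∩ S).ncard ≤ 6 := by
    intro v hv
    have h1 := hle v hv
    have h2 := (hexc v hv).2.2
    simp only [he] at h1
    omega
  have hdisj : Disjoint {v | v ∉ S ∧ L.Adj v s ∧ ¬ L.Adj v t}
      {v | v ∉ S ∧ L.Adj v t ∧ ¬ L.Adj v s} :=
    Set.disjoint_left.2 fun v hv hv' => hv.2.2 hv'.2.1
  have h2 := (Set.ncard_le_ncard (Set.union_subset (hbad s hs t ht hst hadj)
    (hbad t ht s hs hst.symm fun h => hadj h.symm)) (Set.toFinite _)).trans hB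
  rw [Set.ncard_union_eq hdisj] at h2
  -- The two sets of one-sided neighbours are disjoint and have at most two elements together, so
  -- one of them has at most one; the situation is symmetric in `s` and `t`.
  by_cases h1 : {v | v ∉ S ∧ L.Adj v s ∧ ¬ L.Adj v t}.ncard ≤ 1
  · exact hmin.commonNeighbors_of_excess hS6 hs ht h1
  · have := hmin.commonNeighbors_of_excess hS6 ht hs (by omega)
    simpa only [and_comm (a := L.Adj _ s)] using this

end

end KnittedPairs

theorem theorem2p6 {V : Type u} [Finite V] (l p : ℕ) (L : SimpleGraph V) (S : Set V)
    (hmin : KnittedPairs.IsMinimalPair l p L S) :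
    (∀ A B : Set V, KnittedPairs.IsRigidSeparation L S A B → ¬ (A ∩ B).ncard ≤ S.ncard) ∧
    ∃ v : V, v ∉ S ∧
      ((Nat.card ↥(insert v (L.neighborSet v)) ≤ p ∧
          p / 2 + 1 ≤ KnittedPairs.minDeg (KnittedPairs.closedNbhdGraph L v)) ∨
       (((Nat.card ↥(insert v (L.neighborSet v)) : ℕ) : ℤ) ≤ (p : ℤ) - 2 ∧
          p / 2 ≤ KnittedPairs.minDeg (KnittedPairs.closedNbhdGraph L v) ∧
          (KnittedPairs.verticesOfDegree (KnittedPairs.closedNbhdGraph L v) (p / 2)).ncard ≤ 2 ∧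
          (KnittedPairs.closedNbhdGraph L v).IsIndepSet
            (KnittedPairs.verticesOfDegree (KnittedPairs.closedNbhdGraph L v) (p / 2))) ∨
       (((Nat.card ↥(insert v (L.neighborSet v)) : ℕ) : ℤ) ≤ (p : ℤ) - 4 ∧
          p / 2 ≤ KnittedPairs.minDeg (KnittedPairs.closedNbhdGraph L v))) := by
  refine ⟨fun A B h _ => ?_, ?_⟩
  · obtain ⟨h1, h2, h3⟩ := KnittedPairs.isRigidSeparation_iff.1 h
    exact hmin.not_rigid h1 h2 h3
  · obtain ⟨v, hv, h⟩ := hmin.exists_good_vertex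
    exact ⟨v, hv, hmin.dense_closedNbhd hv h⟩
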